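/- Throughout, $L^m=\{z\in\mathbb R^m : z_m\ge (z_1^2+\dots+z_{m-1}^2)^{1/2}\}$ ($m\ge 1$) is the second-order cone; $z\ge_{L^m}0$ means $z\in L^m$ and $z>_{L^m}0$ means that the inequality is strict. A set $\mathscr W\subseteq\mathbb R^d$ is *second-order cone representable* if there are finitely many matrices $A_j$ and vectors $b_j$ such that $y\in\mathscr W\iff\exists v:\ A_j\binom{y}{v}-b_j\ge_{L^{m_j}}0$ for all $j$. A family $\mathscr W(\theta)$, with $\theta$ in a subset $D$ of some $\mathbb R^p$, is *differentiable parameterized second-order cone representable* if the same holds for every $\theta\in D$ with $A_j(\theta),b_j(\theta)$ whose number and sizes do not depend on $\theta$ and whose entries are differentiable in $\theta$ on $D$. **Ambiguity set.** Let $\varXi\subseteq\mathbb R^K$ be second-order cone representable, and for $i=1,\dots,I$ let $\mathcal A_i\subseteq\mathbb R^{p_i}$ and $g_i:\mathbb R^K\times\mathbb R^{p_i}\to\mathbb R$ be such that the epigraphs $\{(y,u): u\ge g_i(y,\alpha_i)\}$, $\alpha_i\in\mathcal A_i$, are differentiable parameterized second-order cone representable. For $\theta=(\alpha,\sigma)\in\Theta:=\prod_i\mathcal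 A_i\times\mathbb R^I$ let $\mathscr U(\theta)$ be the set of all Borel probability measures $\mathbb P$ on $\mathbb R^K$ with $\mathbb P(\varXi)=1$ such that each $g_i(\cdot,\alpha_i)$ is $\mathbb P$-integrable with $\mathbb E_{\mathbb P}[g_i(y,\alpha_i)]\le\sigma_i$. The set $$\mathscr V(\theta)=\{(y,u)\in\mathbb R^K\times\mathbb R^I:\ y\in\varXi,\ g_i(y,\alpha_i)\le u_i\ \forall i\}$$ is then differentiable parameterized second-order cone representable; fix such a representation, with data $A_j(\theta),b_j(\theta)$, $\theta\in\Theta$. *Slater's condition* holds at $\theta$ if there is $(y^*,u^*,v^*)$ with $u_i^*<\sigma_i$ for all $i$ and $A_j(\theta)(y^*,u^*,v^*)^T-b_j(\theta)>_{L^{m_j}}0$ for all $j$. **Cost.** Let $\mathcal X\subseteq\mathbb R^n$ be any set and suppose that one of the following holds. (i) (single stage) $c(x,y)=\sum_{k=1}^K c_k(x)y_k$, where each $c_k:\mathbb R^n\to\mathbb R$ has a second-order cone representable epigraph, and $y\ge 0$ for all $y\in\varXi$. (ii) (two stages, relatively complete recourse) There are $T_0,\dots,T_K$, $h_0,\dots,h_K$,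 $W$, $q$ such that for all $x\in\mathcal X$ and $y\in\varXi$ the linear program $$\min_{\gamma\ge0}\ q^T\gamma\quad\text{s.t.}\quad \Big(T_0+\sum_k y_kT_k\Big)x+W\gamma=h_0+\sum_k y_kh_k$$ is feasible and attains its minimum, which is $c(x,y)$. **Theorem.** There is a linear second-order cone program in a variable $w$, $$\min_w\ \hat q(\theta)^Tw\quad\text{s.t.}\quad \hat A_j(\theta)\binom{x}{w}-\hat b_j(\theta)\ge_{L^{\hat m_j}}0\ \ \forall j\in[\hat J],$$ with finitely many constraints, all affine in $(x,w)$, whose number and sizes do not depend on $(x,\theta)$ and whose data $\hat q,\hat A_j,\hat b_j$ do not depend on $x$ and are differentiable in $\theta$ on $\Theta$, such that for every $\theta\in\Theta$ at which Slater's condition holds and every $x\in\mathcal X$ the worst-case expectation $$f(x,\mathscr U(\theta))=\sup_{\mathbb P\in\mathscr U(\theta)}\mathbb E_{y\sim\mathbb P}[c(x,y)]\in(-\infty,+\infty]$$ equals the optimal value of this program ($+\infty$ if it is infeasible), and the minimum in the program is attained whenever $f(x,\mathscr U(\theta))<+\infty$. (Here $\mathbb E[c]=\mathbb E[c^+]-\mathbb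 E[c^-]$ as an extended real number; measures for which both parts are infinite do not enter the supremum.) -/

import Mathlib

open MeasureTheory

noncomputable section

/-- The second-order cone of dimension `m + 1`: the last coordinate dominates the Euclidean norm
of the first `m` coordinates. -/
def secondOrderCone (m : ℕ) : Set (Fin (m + 1) → ℝ) :=
  {z | Real.sqrt (∑ i : Fin m, z i.castSucc ^ 2) ≤ z (Fin.last m)}

/-- The interior of the second-order cone, `z >_L 0`. -/
def secondOrderConeStrict (m : ℕ) : Set (Fin (m + 1) → ℝ) :=
  {z | Real.sqrt (∑ i : Fin m, z i.castSucc ^ 2) < z (Fin.last m)}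

/-- A finite system of second-order cone inequalities `A_j(θ) [y; v] - b_j(θ) ≥ 0` in the
variables `y` (indexed by `ι`) and the auxiliary variables `v` (indexed by `N`), whose data depend
on a parameter `θ : P`. Number and dimensions of the inequalities and the number of auxiliary
variables do not depend on `θ`. -/
structure SOCSystem (P : Type) (ι : Type) where
  J : Type
  [fintypeJ : Fintype J]
  N : Type
  [fintypeN : Fintype N]
  m : J → ℕ
  A : P → (j : J) → Matrix (Fin (m j + 1)) (ι ⊕ N) ℝ
  b : P → (j : J) → Fin (m j + 1) → ℝ

attribute [instance] SOCSystem.fintypeJ SOCSystem.fintypeN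

namespace SOCSystem

variable {P ι : Type} [Fintype ι]

/-- `(y, v)` satisfies all the inequalities at the parameter `θ`. -/
def Holds (S : SOCSystem P ι) (θ : P) (y : ι → ℝ) (v : S.N → ℝ) : Prop :=
  ∀ j, (S.A θ j).mulVec (Sum.elim y v) - S.b θ j ∈ secondOrderCone (S.m j)

/-- `(y, v)` satisfies all the inequalities strictly at the parameter `θ`. -/
def HoldsStrictly (S : SOCSystem P ι) (θ : P) (y : ι → ℝ) (v : S.N → ℝ) : Prop :=
  ∀ j, (S.A θ j).mulVec (Sum.elim y v) - S.b θ j ∈ secondOrderConeStrict (S.m j)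

/-- All entries of the data are differentiable functions of the parameter on `D`. -/
def DataDifferentiableOn {P ι : Type} [NormedAddCommGroup P] [NormedSpace ℝ P]
    (S : SOCSystem P ι) (D : Set P) : Prop :=
  (∀ j r c, DifferentiableOn ℝ (fun θ => S.A θ j r c) D) ∧
  (∀ j r, DifferentiableOn ℝ (fun θ => S.b θ j r) D)

/-- `S` is a differentiable parameterized second-order cone representation of the family of sets
`W θ`, `θ ∈ D`. -/
def Represents [NormedAddCommGroup P] [NormedSpace ℝ P]
    (S : SOCSystem P ι) (D : Set P) (W : P → Set (ι → ℝ)) : Prop :=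
  S.DataDifferentiableOn D ∧ ∀ θ ∈ D, ∀ y, y ∈ W θ ↔ ∃ v, S.Holds θ y v

/-- The optimal value of the linear second-order cone program
`min_w q(θ)ᵀ w` subject to `A_j(θ) [x; w] - b_j(θ) ≥ 0` for all `j`
(`⊤` if it is infeasible, `⊥` if it is unbounded). -/
def programValue (S : SOCSystem P ι) (q : P → S.N → ℝ) (θ : P) (x : ι → ℝ) : EReal :=
  ⨅ (w : S.N → ℝ) (_ : S.Holds θ x w), ((q θ ⬝ᵥ w : ℝ) : EReal)

end SOCSystem

/-- Second-order cone representable sets (no parameter). -/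
def SOCRepresentable {ι : Type} [Fintype ι] (W : Set (ι → ℝ)) : Prop :=
  ∃ S : SOCSystem Unit ι, ∀ y, y ∈ W ↔ ∃ v, S.Holds () y v

/-- Differentiable parameterized second-order cone representable sets, for parameters in `D`. -/
def DiffParamSOCRepresentable {P ι : Type} [Fintype ι] [NormedAddCommGroup P] [NormedSpace ℝ P]
    (D : Set P) (W : P → Set (ι → ℝ)) : Prop :=
  ∃ S : SOCSystem P ι, S.Represents D W

/-- The epigraph of `f`, with the extra coordinate indexed by `Unit`. -/
def epigraph {ι : Type} (f : (ι → ℝ) → ℝ) : Set (ι ⊕ Unit → ℝ) :=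
  {z | f (fun k => z (Sum.inl k)) ≤ z (Sum.inr ())}

/-- The data of a parameterized SOC ambiguity set for an uncertainty in `ℝ^K` with `I` moment
constraints: a support `Ξ` and functions `g i (y, α i)`, with `α i` in a domain `𝒜 i ⊆ ℝ^(p i)`. -/
structure ParamSOCAmbiguity (K I : ℕ) where
  p : Fin I → ℕ
  dom : (i : Fin I) → Set (Fin (p i) → ℝ)
  supp : Set (Fin K → ℝ)
  g : (i : Fin I) → (Fin K → ℝ) → (Fin (p i) → ℝ) → ℝ
  supp_representable : SOCRepresentable supp
  epi_representable : ∀ i,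
    DiffParamSOCRepresentable (dom i) (fun α => epigraph (fun y => g i y α))

namespace ParamSOCAmbiguity

variable {K I : ℕ}

/-- The parameter `θ = (α, σ)`. -/
abbrev Param (U : ParamSOCAmbiguity K I) : Type :=
  ((i : Fin I) → Fin (U.p i) → ℝ) × (Fin I → ℝ)

/-- The admissible parameters: `α i ∈ 𝒜 i`; the bounds `σ` are unrestricted. -/
def paramDom (U : ParamSOCAmbiguity K I) : Set U.Param :=
  {θ | ∀ i, θ.1 i ∈ U.dom i}

/-- The ambiguity set `𝒰(θ)`: probability distributions concentrated on the support such that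
each `g i` has an expectation bounded by `σ i`. -/
def toSet (U : ParamSOCAmbiguity K I) (θ : U.Param) : Set (Measure (Fin K → ℝ)) :=
  {μ | IsProbabilityMeasure μ ∧ (∀ᵐ y ∂μ, y ∈ U.supp) ∧
    ∀ i, Integrable (fun y => U.g i y (θ.1 i)) μ ∧ ∫ y, U.g i y (θ.1 i) ∂μ ≤ θ.2 i}

/-- The lifted support `𝒱(θ) = {(y, u) | y ∈ Ξ, g i (y, α i) ≤ u i for all i}`. -/
def lifted (U : ParamSOCAmbiguity K I) (θ : U.Param) : Set (Fin K ⊕ Fin I → ℝ) :=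
  {z | (fun k => z (Sum.inl k)) ∈ U.supp ∧
    ∀ i, U.g i (fun k => z (Sum.inl k)) (θ.1 i) ≤ z (Sum.inr i)}

/-- Slater's condition at `θ`, for a representation `R` of the lifted support: some `(y, u, v)`
satisfies all the second-order cone inequalities of `R` strictly, and `u i < σ i` for all `i`. -/
def Slater (U : ParamSOCAmbiguity K I) (R : SOCSystem U.Param (Fin K ⊕ Fin I))
    (θ : U.Param) : Prop :=
  ∃ (y : Fin K → ℝ) (u : Fin I → ℝ) (v : R.N → ℝ),
    (∀ i, u i < θ.2 i) ∧ R.HoldsStrictly θ (Sum.elim y u) v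

/-- The lifted support always has a differentiable parameterized second-order cone representation,
obtained by stacking the representations of the support and of the epigraphs. -/
theorem exists_represents_lifted (U : ParamSOCAmbiguity K I) :
    ∃ R : SOCSystem U.Param (Fin K ⊕ Fin I), R.Represents U.paramDom U.lifted := by
  obtain ⟨S₀, h₀⟩ := U.supp_representable
  choose S hd hr using U.epi_representable
  let R : SOCSystem U.Param (Fin K ⊕ Fin I) :=
    { J := S₀.J ⊕ (Σ i, (S i).J)
      N := S₀.N ⊕ (Σ i, (S i).N)
      m := Sum.elim S₀.m (fun s => (S s.1).m s.2)
      A := fun θ j => match j with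
        | Sum.inl j => fun r c => match c with
          | Sum.inl (Sum.inl k) => S₀.A () j r (Sum.inl k)
          | Sum.inl (Sum.inr _) => 0
          | Sum.inr (Sum.inl a) => S₀.A () j r (Sum.inr a)
          | Sum.inr (Sum.inr _) => 0
        | Sum.inr ⟨i, j⟩ => fun r c => match c with
          | Sum.inl (Sum.inl k) => (S i).A (θ.1 i) j r (Sum.inl (Sum.inl k))
          | Sum.inl (Sum.inr i') =>
              if i' = i then (S i).A (θ.1 i) j r (Sum.inl (Sum.inr ())) else 0
          | Sum.inr (Sum.inl _) => 0
          | Sum.inr (Sum.inr ⟨i', a⟩) =>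
              if h : i' = i then (S i).A (θ.1 i) j r (Sum.inr (h ▸ a)) else 0
      b := fun θ j => match j with
        | Sum.inl j => S₀.b () j
        | Sum.inr ⟨i, j⟩ => (S i).b (θ.1 i) j }
  have hproj : ∀ i, DifferentiableOn ℝ (fun θ : U.Param => θ.1 i) U.paramDom := by
    intro i
    fun_prop
  have hmaps : ∀ i, Set.MapsTo (fun θ : U.Param => θ.1 i) U.paramDom (U.dom i) :=
    fun i θ hθ => hθ i
  have key : ∀ (θ : U.Param) (z : Fin K ⊕ Fin I → ℝ) (v : R.N → ℝ),
      R.Holds θ z v ↔ S₀.Holds () (fun k => z (Sum.inl k)) (fun a => v (Sum.inl a)) ∧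
        ∀ i, (S i).Holds (θ.1 i)
          (Sum.elim (fun k => z (Sum.inl k)) (fun _ => z (Sum.inr i)))
          (fun a => v (Sum.inr ⟨i, a⟩)) := by
    intro θ z v
    have e₀ : ∀ j, (R.A θ (Sum.inl j)).mulVec (Sum.elim z v) =
        (S₀.A () j).mulVec
          (Sum.elim (fun k => z (Sum.inl k)) (fun a => v (Sum.inl a))) := by
      intro j
      funext r
      simp only [Matrix.mulVec, dotProduct, Fintype.sum_sum_type, Sum.elim_inl, Sum.elim_inr]
      erw [Fintype.sum_sum_type]
      simp [R]
    have e₁ : ∀ i j, (R.A θ (Sum.inr ⟨i, j⟩)).mulVec (Sum.elim z v) =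
        ((S i).A (θ.1 i) j).mulVec
          (Sum.elim (Sum.elim (fun k => z (Sum.inl k)) (fun _ => z (Sum.inr i)))
            (fun a => v (Sum.inr ⟨i, a⟩))) := by
      intro i j
      funext r
      simp only [Matrix.mulVec, dotProduct, Fintype.sum_sum_type, Sum.elim_inl, Sum.elim_inr]
      erw [Fintype.sum_sum_type]
      simp only [R, zero_mul, Finset.sum_const_zero, zero_add]
      rw [Fintype.sum_sigma, Finset.sum_eq_single i]
      · simp
      · intro i' _ hi'
        simp [hi']
      · simp
    constructor
    · intro h
      refine ⟨fun j => ?_, fun i j => ?_⟩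
      · have := h (Sum.inl j)
        rw [e₀] at this
        exact this
      · have := h (Sum.inr ⟨i, j⟩)
        rw [e₁] at this
        exact this
    · rintro ⟨h, h'⟩ (j | ⟨i, j⟩)
      · rw [e₀]
        exact h j
      · rw [e₁]
        exact h' i j
  have hS : ∀ (θ : U.Param), θ ∈ U.paramDom → ∀ (z : Fin K ⊕ Fin I → ℝ) (i : Fin I),
      U.g i (fun k => z (Sum.inl k)) (θ.1 i) ≤ z (Sum.inr i) ↔
        ∃ v, (S i).Holds (θ.1 i)
          (Sum.elim (fun k => z (Sum.inl k)) (fun _ => z (Sum.inr i))) v := by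
    intro θ hθ z i
    rw [← hr i (θ.1 i) (hθ i)]
    simp [epigraph]
  refine ⟨R, ⟨?_, ?_⟩, ?_⟩
  · rintro (j | ⟨i, j⟩) r ((k | i') | (a | ⟨i', a⟩))
    · exact differentiableOn_const _
    · exact differentiableOn_const _
    · exact differentiableOn_const _
    · exact differentiableOn_const _
    · exact ((hd i).1 j r _).comp (hproj i) (hmaps i)
    · by_cases h : i' = i
      · subst h
        exact (((hd i').1 j r (Sum.inl (Sum.inr ()))).comp (hproj i') (hmaps i')).congr
          (fun θ _ => by simp [R])
      · simp [R, h]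
    · exact differentiableOn_const _
    · by_cases h : i' = i
      · subst h
        exact (((hd i').1 j r (Sum.inr a)).comp (hproj i') (hmaps i')).congr
          (fun θ _ => by simp [R])
      · simp [R, h]
  · rintro (j | ⟨i, j⟩) r
    · exact differentiableOn_const _
    · exact ((hd i).2 j r).comp (hproj i) (hmaps i)
  · intro θ hθ z
    constructor
    · rintro ⟨h, h'⟩
      obtain ⟨v₀, hv₀⟩ := (h₀ _).1 h
      choose v hv using fun i => (hS θ hθ z i).1 (h' i)
      exact ⟨Sum.elim v₀ (fun s => v s.1 s.2), (key θ z _).2 ⟨hv₀, hv⟩⟩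
    · rintro ⟨v, hv⟩
      obtain ⟨h, h'⟩ := (key θ z v).1 hv
      exact ⟨(h₀ _).2 ⟨_, h⟩, fun i => (hS θ hθ z i).2 ⟨_, h' i⟩⟩

end ParamSOCAmbiguity

/-- The extended expectation `E[φ⁺] - E[φ⁻]`; it is the usual expectation if `φ` is integrable, and
`⊥` (hence irrelevant for a supremum) if both parts have infinite expectation. -/
def extExpectation {Ω : Type} [MeasurableSpace Ω] (μ : Measure Ω) (φ : Ω → ℝ) : EReal :=
  ((∫⁻ y, ENNReal.ofReal (φ y) ∂μ : ENNReal) : EReal) -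
    ((∫⁻ y, ENNReal.ofReal (-φ y) ∂μ : ENNReal) : EReal)

/-- The worst-case expectation `f(x, 𝒰(θ)) = sup_{ℙ ∈ 𝒰(θ)} E_ℙ[c(x, y)]`. -/
def worstCaseExpectation {n K I : ℕ} (U : ParamSOCAmbiguity K I)
    (c : (Fin n → ℝ) → (Fin K → ℝ) → ℝ) (θ : U.Param) (x : Fin n → ℝ) : EReal :=
  ⨆ μ ∈ U.toSet θ, extExpectation μ (c x)

/-- Single-stage cost: `c(x, y) = ∑ k, c_k(x) y_k` where the epigraph of each `c_k` is second-order
cone representable and the uncertainty is nonnegative. -/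
def IsSingleStageCost {n K : ℕ} (supp : Set (Fin K → ℝ))
    (c : (Fin n → ℝ) → (Fin K → ℝ) → ℝ) : Prop :=
  (∃ ck : Fin K → (Fin n → ℝ) → ℝ,
    (∀ k, SOCRepresentable (epigraph (ck k))) ∧ ∀ x y, c x y = ∑ k, ck k x * y k) ∧
  ∀ y ∈ supp, ∀ k, 0 ≤ y k

/-- The feasible set `{γ ≥ 0 | (T₀ + ∑ k, y_k T_k) x + W γ = h₀ + ∑ k, y_k h_k}` of the recourse
problem. -/
def recourseFeasible {n K M G : ℕ} (T₀ : Matrix (Fin M) (Fin n) ℝ)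
    (T : Fin K → Matrix (Fin M) (Fin n) ℝ) (h₀ : Fin M → ℝ) (h : Fin K → Fin M → ℝ)
    (W : Matrix (Fin M) (Fin G) ℝ) (x : Fin n → ℝ) (y : Fin K → ℝ) : Set (Fin G → ℝ) :=
  {γ | (∀ l, 0 ≤ γ l) ∧
    (T₀ + ∑ k, y k • T k).mulVec x + W.mulVec γ = h₀ + ∑ k, y k • h k}

/-- Two-stage cost with relatively complete recourse: for all `x ∈ X` and all `y` in the support the
recourse problem is feasible, and `c(x, y)` is its minimum. -/
def IsTwoStageCost {n K : ℕ} (X : Set (Fin n → ℝ)) (supp : Set (Fin K → ℝ))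
    (c : (Fin n → ℝ) → (Fin K → ℝ) → ℝ) : Prop :=
  ∃ (M G : ℕ) (T₀ : Matrix (Fin M) (Fin n) ℝ) (T : Fin K → Matrix (Fin M) (Fin n) ℝ)
    (h₀ : Fin M → ℝ) (h : Fin K → Fin M → ℝ) (W : Matrix (Fin M) (Fin G) ℝ) (q : Fin G → ℝ),
    ∀ x ∈ X, ∀ y ∈ supp,
      (recourseFeasible T₀ T h₀ h W x y).Nonempty ∧
      IsLeast ((fun γ => q ⬝ᵥ γ) '' recourseFeasible T₀ T h₀ h W x y) (c x y)

end

/-! The worst-case expectation is a moment problem, and its dual minimizes `r + ∑ β i σ i` over `β ≥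
0` subject to `c x y ≤ r + ∑ β i g i y` on the support. Weak duality is integration. For strong
duality (`exists_moment_dual`), the convex hull of the points `(g y, c x y)` is separated from the
open box of moments below `σ` and costs above `f`. Hull points are realized by finite Dirac
mixtures, and the Slater point makes the separating hyperplane non-vertical, so the dual is
attained.

The semi-infinite dual constraint becomes conic in two moves. The cost is a finite maximum of
functions `a_l + d_l y` whose coefficients are affine in `x` and auxiliary variables
(`CostRepresentation`). In the single-stage case these variables bound the `c_k`; in the two-stage
case the pieces come from finitely many LP multipliers. Since `β ≥ 0`, the constraint then says that
each `r + β u - a_l - d_l y` is nonnegative on the lifted support. That support is a second-order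
cone set with a Slater point, so by `exists_dual_multipliers` nonnegativity is equivalent to a
certificate `λ_l` in the self-dual cones.

The parameter enters only through `A(θ)` and `b(θ)`, multiplied by the `λ_l`, and through `σ` in the
objective. The program is therefore linear in its variables with differentiable data. -/

/-! ### Linear programming duality -/

/-- **Farkas' lemma** for finitely many linear functionals on a real vector space. -/
theorem farkas_finset {V ι : Type*} [AddCommGroup V] [Module ℝ V] (s : Finset ι)
    (a : ι → V →ₗ[ℝ] ℝ) (q : V →ₗ[ℝ] ℝ)
    (h : ∀ v, (∀ i ∈ s, 0 ≤ a i v) → 0 ≤ q v) :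
    ∃ c : ι → ℝ, (∀ i, 0 ≤ c i) ∧ ∀ v, q v = ∑ i ∈ s, c i * a i v := by
  classical
  induction s using Finset.induction_on generalizing a q with
  | empty =>
    refine ⟨0, fun _ => le_rfl, fun v => ?_⟩
    have h₁ := h v (by simp)
    have h₂ := h (-v) (by simp)
    rw [map_neg] at h₂
    simp only [Finset.sum_empty]
    linarith
  | insert k s hk ih =>
    by_cases hs : ∀ v, (∀ i ∈ s, 0 ≤ a i v) → 0 ≤ q v
    · obtain ⟨c, hc, hq⟩ := ih a q hs
      refine ⟨Function.update c k 0, fun i => ?_, fun v => ?_⟩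
      · by_cases hi : i = k
        · subst hi; simp
        · simp [hi, hc i]
      · rw [Finset.sum_insert hk, hq v]
        simp only [Function.update_self, zero_mul, zero_add]
        refine Finset.sum_congr rfl fun i hi => ?_
        rw [Function.update_of_ne (ne_of_mem_of_not_mem hi hk)]
    · push Not at hs
      obtain ⟨v₀, hv₀, hq₀⟩ := hs
      have hk₀ : a k v₀ < 0 := by
        by_contra hcon
        push Not at hcon
        refine absurd (h v₀ fun i hi => ?_) (not_le.2 hq₀)
        rcases Finset.mem_insert.1 hi with rfl | hi
        · exact hcon
        · exact hv₀ i hi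
      obtain ⟨t, ht, v, rfl, hkv⟩ : ∃ t : ℝ, 0 < t ∧ ∃ v, v = t • v₀ ∧ a k v = -1 := by
        refine ⟨-(a k v₀)⁻¹, by simpa using hk₀, _, rfl, ?_⟩
        have := hk₀.ne
        simp [this]
      set v := t • v₀ with hv
      have hva : ∀ i ∈ s, 0 ≤ a i v := fun i hi => by
        rw [hv, map_smul]; exact mul_nonneg ht.le (hv₀ i hi)
      have hvq : q v < 0 := by
        rw [hv, map_smul]; exact mul_neg_of_pos_of_neg ht hq₀
      -- Since `a k v = -1`, the map `w ↦ w + a k w • v` projects onto the kernel of `a k`. The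
      -- induction hypothesis is applied to the functionals composed with this projection; undoing
      -- it gives `a k` the coefficient `∑ c i * a i v - q v`, which is nonnegative because `q v <
      -- 0`.
      obtain ⟨c, hc, hq⟩ := ih (fun i => a i + a i v • a k) (q + q v • a k) fun w hw => by
        have := h (w + a k w • v) fun i hi => by
          rcases Finset.mem_insert.1 hi with rfl | hi
          · simp [hkv]
          · have := hw i hi
            simp only [LinearMap.add_apply, LinearMap.smul_apply, smul_eq_mul] at this
            simp only [map_add, map_smul, smul_eq_mul]
            linarith
        simp only [map_add, map_smul, smul_eq_mul] at this
        simp only [LinearMap.add_apply, LinearMap.smul_apply, smul_eq_mul]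
        linarith
      have hd : 0 ≤ ∑ i ∈ s, c i * a i v - q v := by
        have := Finset.sum_nonneg fun i hi => mul_nonneg (hc i) (hva i hi)
        linarith
      refine ⟨Function.update c k (∑ i ∈ s, c i * a i v - q v), fun i => ?_, fun w => ?_⟩
      · by_cases hi : i = k
        · subst hi; simpa using hd
        · simp [hi, hc i]
      · have hw := hq w
        simp only [LinearMap.add_apply, LinearMap.smul_apply, smul_eq_mul] at hw
        rw [Finset.sum_insert hk, Function.update_self]
        have e : ∑ i ∈ s, Function.update c k (∑ i ∈ s, c i * a i v - q v) i * a i w =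
            ∑ i ∈ s, c i * a i w := Finset.sum_congr rfl fun i hi => by
          rw [Function.update_of_ne (ne_of_mem_of_not_mem hi hk)]
        have e' : ∑ i ∈ s, c i * (a i w + a i v * a k w) =
            ∑ i ∈ s, c i * a i w + (∑ i ∈ s, c i * a i v) * a k w := by
          rw [Finset.sum_mul, ← Finset.sum_add_distrib]
          exact Finset.sum_congr rfl fun i _ => by ring
        rw [e]
        rw [e'] at hw
        linarith

/-- A minimizer `γ` of a linear program in standard form has a dual feasible multiplier that is
complementary to it. -/
theorem exists_complementary_multiplier {M G : Type*} [Fintype M] [Fintype G]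
    (W : Matrix M G ℝ) (q γ : G → ℝ) (hγ : ∀ l, 0 ≤ γ l)
    (hmin : ∀ γ', (∀ l, 0 ≤ γ' l) → W.mulVec γ' = W.mulVec γ → q ⬝ᵥ γ ≤ q ⬝ᵥ γ') :
    ∃ π : M → ℝ, (∀ l, Matrix.vecMul π W l ≤ q l) ∧
      ∀ l, γ l ≠ 0 → Matrix.vecMul π W l = q l := by
  classical
  -- Such a `d` is a feasible direction: a short step can only endanger coordinates where `γ`
  -- vanishes, and there `d` is nonnegative.
  have hdir : ∀ d : G → ℝ, W.mulVec d = 0 → (∀ l, γ l = 0 → 0 ≤ d l) → 0 ≤ q ⬝ᵥ d := by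
    intro d hd hd'
    have hev : ∀ᶠ ε : ℝ in nhdsWithin 0 (Set.Ioi 0), ∀ l, 0 ≤ γ l + ε * d l := by
      rw [Filter.eventually_all]
      intro l
      by_cases hl : γ l = 0
      · filter_upwards [self_mem_nhdsWithin] with ε hε
        rw [hl, zero_add]
        exact mul_nonneg (le_of_lt hε) (hd' l hl)
      · have hpos : 0 < γ l := lt_of_le_of_ne (hγ l) (Ne.symm hl)
        have hcont : Filter.Tendsto (fun ε : ℝ => γ l + ε * d l) (nhds 0) (nhds (γ l)) := by
          have : Continuous fun ε : ℝ => γ l + ε * d l := by fun_prop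
          simpa using this.tendsto 0
        exact Filter.Eventually.filter_mono nhdsWithin_le_nhds
          ((hcont.eventually (lt_mem_nhds hpos)).mono fun _ h => le_of_lt h)
    obtain ⟨ε, hε, hε'⟩ := (hev.and self_mem_nhdsWithin).exists
    have h1 := hmin (γ + ε • d) (by simpa using hε)
      (by rw [Matrix.mulVec_add, Matrix.mulVec_smul, hd, smul_zero, add_zero])
    rw [dotProduct_add, dotProduct_smul, smul_eq_mul] at h1
    exact nonneg_of_mul_nonneg_right (by linarith) (show (0 : ℝ) < ε from hε')
  -- The equation `W d = 0` is split into two inequalities, so the multiplier `π` is a difference of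
  -- two nonnegative vectors. The remaining functionals are supported where `γ` vanishes, which
  -- yields complementarity.
  let a : (M ⊕ M) ⊕ {l // γ l = 0} → (G → ℝ) →ₗ[ℝ] ℝ :=
    Sum.elim (Sum.elim (fun i => LinearMap.proj i ∘ₗ W.mulVecLin)
      (fun i => -(LinearMap.proj i ∘ₗ W.mulVecLin))) (fun l => LinearMap.proj l.1)
  let φ : (G → ℝ) →ₗ[ℝ] ℝ := dotProductBilin ℝ ℝ q
  obtain ⟨c, hc, hq⟩ := farkas_finset Finset.univ a φ fun d hd => by
    refine hdir d ?_ fun l hl => ?_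
    · funext i
      have h1 := hd (Sum.inl (Sum.inl i)) (Finset.mem_univ _)
      have h2 := hd (Sum.inl (Sum.inr i)) (Finset.mem_univ _)
      simp [a] at h1 h2
      exact le_antisymm h2 h1
    · simpa [a] using hd (Sum.inr ⟨l, hl⟩) (Finset.mem_univ _)
  refine ⟨fun i => c (Sum.inl (Sum.inl i)) - c (Sum.inl (Sum.inr i)), ?_⟩
  have key : ∀ l, q l = Matrix.vecMul
      (fun i => c (Sum.inl (Sum.inl i)) - c (Sum.inl (Sum.inr i))) W l +
        ∑ l' : {l // γ l = 0}, c (Sum.inr l') * (Pi.single l 1 : G → ℝ) l'.1 := by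
    intro l
    have := hq (Pi.single l 1)
    simp only [φ, a, dotProductBilin_apply_apply, dotProduct_single, mul_one,
      Fintype.sum_sum_type, Sum.elim_inl, Sum.elim_inr, LinearMap.neg_apply, LinearMap.comp_apply,
      LinearMap.proj_apply, Matrix.mulVecLin_apply, Matrix.mulVec_single_one] at this
    rw [this, Matrix.vecMul, dotProduct, ← Finset.sum_add_distrib]
    congr 1
    refine Finset.sum_congr rfl fun i _ => ?_
    simp only [Matrix.col_apply]
    ring
  refine ⟨fun l => ?_, fun l hl => ?_⟩
  · rw [key l]
    refine le_add_of_nonneg_right (Finset.sum_nonneg fun l' _ => mul_nonneg (hc _) ?_)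
    rw [Pi.single_apply]; split_ifs <;> norm_num
  · rw [key l, Finset.sum_eq_zero, add_zero]
    intro l' _
    rw [Pi.single_eq_of_ne, mul_zero]
    intro h
    exact hl (h ▸ l'.2)

/-! ### Geometry of the second-order cone -/

theorem secondOrderConeStrict_subset (m : ℕ) : secondOrderConeStrict m ⊆ secondOrderCone m :=
  fun _ h => le_of_lt (Set.mem_ofPred.1 h)

theorem mem_secondOrderCone_zero_iff (z : Fin (0 + 1) → ℝ) :
    z ∈ secondOrderCone 0 ↔ 0 ≤ z 0 := by
  simp [secondOrderCone]

theorem sqrt_sum_sq_eq_norm {m : ℕ} (z : Fin (m + 1) → ℝ) :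
    Real.sqrt (∑ i : Fin m, z i.castSucc ^ 2) =
      ‖(WithLp.toLp 2 fun i : Fin m => z i.castSucc : EuclideanSpace ℝ (Fin m))‖ := by
  rw [EuclideanSpace.norm_eq]
  simp

/-- Cauchy–Schwarz bounds the inner product of the first coordinates below by minus the product of
their norms, which the product of the last coordinates dominates. -/
theorem secondOrderCone_dotProduct_nonneg {m : ℕ} {z w : Fin (m + 1) → ℝ}
    (hz : z ∈ secondOrderCone m) (hw : w ∈ secondOrderCone m) : 0 ≤ z ⬝ᵥ w := by
  have hz' : Real.sqrt (∑ i : Fin m, z i.castSucc ^ 2) ≤ z (Fin.last m) := hz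
  have hw' : Real.sqrt (∑ i : Fin m, w i.castSucc ^ 2) ≤ w (Fin.last m) := hw
  have hcs := Real.sum_mul_le_sqrt_mul_sqrt Finset.univ
    (fun i : Fin m => -z i.castSucc) (fun i => w i.castSucc)
  simp only [neg_mul, Finset.sum_neg_distrib, neg_sq] at hcs
  have := mul_le_mul hz' hw' (Real.sqrt_nonneg _) ((Real.sqrt_nonneg _).trans hz')
  rw [dotProduct, Fin.sum_univ_castSucc]
  linarith

/-- The second-order cone is self-dual; it suffices to test against its interior. -/
theorem mem_secondOrderCone_of_dotProduct_nonneg {m : ℕ} {z : Fin (m + 1) → ℝ}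
    (h : ∀ w ∈ secondOrderConeStrict m, 0 ≤ z ⬝ᵥ w) : z ∈ secondOrderCone m := by
  change Real.sqrt (∑ i : Fin m, z i.castSucc ^ 2) ≤ z (Fin.last m)
  set N := Real.sqrt (∑ i : Fin m, z i.castSucc ^ 2) with hN
  have hN0 : 0 ≤ N := Real.sqrt_nonneg _
  have hNsq : ∑ i : Fin m, z i.castSucc ^ 2 = N ^ 2 :=
    (Real.sq_sqrt (Finset.sum_nonneg fun i _ => sq_nonneg _)).symm
  have key : ∀ ε : ℝ, 0 < ε → 0 ≤ -N ^ 2 + z (Fin.last m) * (N + ε) := by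
    intro ε hε
    -- The test vector reverses the first coordinates of `z`; the `ε` puts it in the interior.
    have := h (Fin.snoc (α := fun _ => ℝ) (fun i : Fin m => -z i.castSucc) (N + ε)) (by
      simp only [secondOrderConeStrict, Set.mem_ofPred_eq, Fin.snoc_castSucc, Fin.snoc_last, neg_sq]
      rw [← hN]
      linarith)
    rw [dotProduct, Fin.sum_univ_castSucc] at this
    simp only [Fin.snoc_castSucc, Fin.snoc_last, mul_neg, Finset.sum_neg_distrib] at this
    simpa only [← pow_two, hNsq] using this
  rcases hN0.eq_or_lt with h0 | hpos
  · have := key 1 one_pos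
    rw [← h0] at this ⊢
    linarith
  · by_contra hlt
    push Not at hlt
    by_cases hz : z (Fin.last m) ≤ 0
    · nlinarith [key 1 one_pos]
    · push Not at hz
      -- This `ε` turns the right-hand side of `key` into half of `N * (z (Fin.last m) - N)`, which
      -- is negative.
      have hε : 0 < N * (N - z (Fin.last m)) / (2 * z (Fin.last m)) :=
        div_pos (mul_pos hpos (by linarith)) (by linarith)
      have := key _ hε
      have e : z (Fin.last m) * (N + N * (N - z (Fin.last m)) / (2 * z (Fin.last m))) =
          z (Fin.last m) * N + N * (N - z (Fin.last m)) / 2 := by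
        field_simp
      rw [e] at this
      nlinarith

theorem isOpen_secondOrderConeStrict (m : ℕ) : IsOpen (secondOrderConeStrict m) :=
  isOpen_lt (by fun_prop) (by fun_prop)

theorem convex_secondOrderConeStrict (m : ℕ) : Convex ℝ (secondOrderConeStrict m) := by
  intro z hz w hw a b ha hb hab
  simp only [secondOrderConeStrict, Set.mem_ofPred_eq, sqrt_sum_sq_eq_norm] at hz hw ⊢
  have e : (WithLp.toLp 2 fun i : Fin m => (a • z + b • w) i.castSucc : EuclideanSpace ℝ (Fin m)) =
      a • WithLp.toLp 2 (fun i : Fin m => z i.castSucc) +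
        b • WithLp.toLp 2 (fun i : Fin m => w i.castSucc) := by
    ext i; simp
  rw [e]
  refine (norm_add_le _ _).trans_lt ?_
  rw [norm_smul, norm_smul, Real.norm_of_nonneg ha, Real.norm_of_nonneg hb]
  simp only [Pi.add_apply, Pi.smul_apply, smul_eq_mul]
  rcases ha.eq_or_lt with rfl | ha'
  · have : b = 1 := by linarith
    subst this
    simpa using hw
  · exact add_lt_add_of_lt_of_le (mul_lt_mul_of_pos_left hz ha')
      (mul_le_mul_of_nonneg_left hw.le hb)

theorem smul_mem_secondOrderConeStrict {m : ℕ} {z : Fin (m + 1) → ℝ}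
    (hz : z ∈ secondOrderConeStrict m) {t : ℝ} (ht : 0 < t) :
    t • z ∈ secondOrderConeStrict m := by
  simp only [secondOrderConeStrict, Set.mem_ofPred_eq, sqrt_sum_sq_eq_norm] at hz ⊢
  have e : (WithLp.toLp 2 fun i : Fin m => (t • z) i.castSucc : EuclideanSpace ℝ (Fin m)) =
      t • WithLp.toLp 2 (fun i : Fin m => z i.castSucc) := by
    ext i; simp
  rw [e, norm_smul, Real.norm_of_nonneg ht.le]
  exact mul_lt_mul_of_pos_left hz ht

theorem single_mem_secondOrderConeStrict (m : ℕ) :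
    (Pi.single (Fin.last m) 1 : Fin (m + 1) → ℝ) ∈ secondOrderConeStrict m := by
  simp [secondOrderConeStrict]

/-! ### Conic strong duality -/

/-- A real number that stays below `s` under all positive multiples is nonpositive. -/
theorem nonpos_of_forall_pos_mul_lt {a s : ℝ} (h : ∀ t : ℝ, 0 < t → t * a < s) : a ≤ 0 := by
  by_contra ha
  push Not at ha
  have := h ((|s| + 1) / a) (by positivity)
  rw [div_mul_cancel₀ _ ha.ne'] at this
  linarith [le_abs_self s]

/-- Real numbers all of whose positive multiples stay below `s` force `0 ≤ s`. -/
theorem nonneg_of_forall_pos_mul_lt {a s : ℝ} (h : ∀ t : ℝ, 0 < t → t * a < s) : 0 ≤ s := by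
  have hlim : Filter.Tendsto (fun t : ℝ => t * a) (nhdsWithin 0 (Set.Ioi 0)) (nhds 0) := by
    have : Continuous fun t : ℝ => t * a := by fun_prop
    exact tendsto_nhdsWithin_of_tendsto_nhds (by simpa using this.tendsto 0)
  exact le_of_tendsto hlim (by
    filter_upwards [self_mem_nhdsWithin] with t ht
    exact (h t ht).le)

/-- An affine function that is bounded below is constant. -/
theorem eq_zero_of_forall_dotProduct_add_nonneg {κ : Type*} [Fintype κ] {ψ : κ → ℝ} {s : ℝ}
    (h : ∀ z : κ → ℝ, 0 ≤ ψ ⬝ᵥ z + s) : ψ = 0 := by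
  classical
  funext k
  have key : ∀ t : ℝ, 0 ≤ ψ k * t + s := fun t => by simpa using h (Pi.single k t)
  by_contra hk
  change ψ k ≠ 0 at hk
  have := key (-(s + 1) / ψ k)
  rw [mul_div_cancel₀ _ hk] at this
  linarith

/-- Strong duality for second-order cone programs under Slater's condition: an affine function that
is nonnegative on the feasible set is certified by dual multipliers. -/
theorem exists_dual_multipliers {J κ : Type*} [Fintype J] [Fintype κ] (m : J → ℕ)
    (A : (j : J) → Matrix (Fin (m j + 1)) κ ℝ) (b : (j : J) → Fin (m j + 1) → ℝ)
    (z₀ : κ → ℝ) (hz₀ : ∀ j, (A j).mulVec z₀ - b j ∈ secondOrderConeStrict (m j))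
    (φ : κ → ℝ) (c₀ : ℝ)
    (h : ∀ z, (∀ j, (A j).mulVec z - b j ∈ secondOrderCone (m j)) → 0 ≤ φ ⬝ᵥ z + c₀) :
    ∃ l : (j : J) → Fin (m j + 1) → ℝ, (∀ j, l j ∈ secondOrderCone (m j)) ∧
      (∑ j, Matrix.vecMul (l j) (A j) = φ) ∧ 0 ≤ ∑ j, l j ⬝ᵥ b j + c₀ := by
  classical
  let O : Set (((j : J) → Fin (m j + 1) → ℝ) × ℝ) :=
    (Set.univ.pi fun j => secondOrderConeStrict (m j)) ×ˢ Set.Iio 0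
  let E : Set (((j : J) → Fin (m j + 1) → ℝ) × ℝ) :=
    Set.range fun z : κ → ℝ => (fun j => (A j).mulVec z - b j, φ ⬝ᵥ z + c₀)
  have hOc : Convex ℝ O :=
    (convex_pi fun j _ => convex_secondOrderConeStrict (m j)).prod (convex_Iio 0)
  have hOo : IsOpen O :=
    (isOpen_set_pi Set.finite_univ fun j _ => isOpen_secondOrderConeStrict (m j)).prod isOpen_Iio
  have hEc : Convex ℝ E := by
    rintro _ ⟨z, rfl⟩ _ ⟨w, rfl⟩ s t - - hst
    refine ⟨s • z + t • w, ?_⟩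
    refine Prod.ext ?_ ?_
    · funext j r
      simp only [Matrix.mulVec_add, Matrix.mulVec_smul, Pi.sub_apply, Pi.add_apply, Pi.smul_apply,
        smul_eq_mul, Prod.smul_mk, Prod.mk_add_mk]
      linear_combination (b j r) * hst
    · simp only [dotProduct_add, dotProduct_smul, smul_eq_mul, Prod.smul_mk, Prod.mk_add_mk]
      linear_combination -c₀ * hst
  -- A common point would be a feasible `z` with a negative value of the affine function.
  have hdisj : Disjoint O E := by
    rw [Set.disjoint_left]
    rintro _ ⟨h1, h2⟩ ⟨z, rfl⟩
    have := h z fun j => secondOrderConeStrict_subset _ (h1 j (Set.mem_univ j))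
    exact absurd h2 (not_lt.2 this)
  obtain ⟨F, s, hFO, hFE⟩ := geometric_hahn_banach_open hOc hOo hEc hdisj
  let μ : (j : J) → Fin (m j + 1) → ℝ :=
    fun j r => F (Pi.single j (Pi.single r 1), 0)
  let η : ℝ := F (0, 1)
  have hF : ∀ (k : (j : J) → Fin (m j + 1) → ℝ) (τ : ℝ), F (k, τ) = ∑ j, μ j ⬝ᵥ k j + η * τ := by
    intro k τ
    have e : (k, τ) = ∑ j, ∑ r, k j r •
        ((Pi.single j (Pi.single r 1), 0) : ((j : J) → Fin (m j + 1) → ℝ) × ℝ) + τ • (0, 1) := by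
      refine Prod.ext ?_ ?_
      · funext j r
        simp only [Prod.fst_add, Prod.fst_sum, Prod.smul_fst, smul_zero, add_zero,
          Finset.sum_apply, Pi.smul_apply, smul_eq_mul]
        rw [Finset.sum_eq_single j, Finset.sum_eq_single r]
        · simp
        · intro r' _ hr'; simp [Ne.symm hr']
        · simp
        · intro j' _ hj'
          refine Finset.sum_eq_zero fun r' _ => ?_
          rw [Pi.single_eq_of_ne (Ne.symm hj')]; simp
        · simp
      · simp [Prod.snd_sum]
    rw [e, map_add, map_sum, map_smul]
    simp only [map_sum, map_smul, smul_eq_mul, dotProduct]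
    rw [mul_comm τ]
    congr 1
    exact Finset.sum_congr rfl fun j _ => Finset.sum_congr rfl fun r _ => mul_comm _ _
  have hO : ∀ k : (j : J) → Fin (m j + 1) → ℝ, (∀ j, k j ∈ secondOrderConeStrict (m j)) →
      ∀ τ < 0, ∑ j, μ j ⬝ᵥ k j + η * τ < s := fun k hk τ hτ => by
    rw [← hF]; exact hFO _ ⟨fun j _ => hk j, hτ⟩
  have hE : ∀ z : κ → ℝ,
      s ≤ ∑ j, μ j ⬝ᵥ ((A j).mulVec z - b j) + η * (φ ⬝ᵥ z + c₀) := fun z => by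
    rw [← hF]; exact hFE _ ⟨z, rfl⟩
  -- `O` is stable under positive scaling: letting the factor tend to zero gives `0 ≤ s`, and
  -- letting it grow gives a nonpositive functional on `O`.
  have hcone : ∀ k : (j : J) → Fin (m j + 1) → ℝ, (∀ j, k j ∈ secondOrderConeStrict (m j)) →
      ∀ τ < 0, ∀ t : ℝ, 0 < t → t * (∑ j, μ j ⬝ᵥ k j + η * τ) < s := fun k hk τ hτ t ht => by
    have := hO (fun j => t • k j) (fun j => smul_mem_secondOrderConeStrict (hk j) ht) (t * τ)
      (mul_neg_of_pos_of_neg ht hτ)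
    simp only [dotProduct_smul, smul_eq_mul, ← Finset.mul_sum] at this
    linarith
  have hs : 0 ≤ s := nonneg_of_forall_pos_mul_lt (hcone _ hz₀ (-1) (by norm_num))
  have hle : ∀ k : (j : J) → Fin (m j + 1) → ℝ, (∀ j, k j ∈ secondOrderConeStrict (m j)) →
      ∀ τ < 0, ∑ j, μ j ⬝ᵥ k j + η * τ ≤ 0 := fun k hk τ hτ =>
    nonpos_of_forall_pos_mul_lt (hcone k hk τ hτ)
  have hη0 : 0 ≤ η := by
    have hmul : ∀ t : ℝ, 0 < t → t * (-η) < s - ∑ j, μ j ⬝ᵥ ((A j).mulVec z₀ - b j) := by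
      intro t ht
      have := hO _ hz₀ (-t) (by linarith)
      linarith
    linarith [nonpos_of_forall_pos_mul_lt hmul]
  -- If `η = 0`, the last coordinate is invisible, and the slack of `z₀` would lie strictly on both
  -- sides of the hyperplane's bound.
  have hη : 0 < η := by
    refine lt_of_le_of_ne hη0 fun h0 => ?_
    have h1 := hO _ hz₀ (-1) (by norm_num)
    have h2 := hE z₀
    rw [← h0] at h1 h2
    linarith
  have hle' : ∀ k : (j : J) → Fin (m j + 1) → ℝ, (∀ j, k j ∈ secondOrderConeStrict (m j)) →
      ∑ j, μ j ⬝ᵥ k j ≤ 0 := fun k hk => by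
    refine le_of_forall_pos_le_add fun ε hε => ?_
    have := hle k hk (-(ε / η)) (by simpa using div_pos hε hη)
    rw [mul_neg, mul_div_cancel₀ _ hη.ne'] at this
    linarith
  have hmem : ∀ j, ∀ w ∈ secondOrderConeStrict (m j), μ j ⬝ᵥ w ≤ 0 := by
    intro j w hw
    have hlim : ∀ ε : ℝ, 0 < ε →
        μ j ⬝ᵥ w + ε * ∑ j' ∈ Finset.univ.erase j, μ j' (Fin.last _) ≤ 0 := by
      intro ε hε
      -- The other blocks must stay in the open cones, so they receive a multiple `ε` of the axis
      -- vector; `ε → 0` isolates block `j`.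
      have := hle' (fun j' => if h : j' = j then h ▸ w else ε • Pi.single (Fin.last _) 1) (by
        intro j'
        by_cases hj : j' = j
        · subst hj; simpa using hw
        · simp only [hj, dite_false]
          exact smul_mem_secondOrderConeStrict (single_mem_secondOrderConeStrict _) hε)
      rw [← Finset.add_sum_erase _ _ (Finset.mem_univ j)] at this
      rw [Finset.mul_sum]
      convert this using 2
      · simp
      · refine Finset.sum_congr rfl fun j' hj' => ?_
        simp [Finset.ne_of_mem_erase hj']
    have hcont : Filter.Tendsto
        (fun ε : ℝ => μ j ⬝ᵥ w + ε * ∑ j' ∈ Finset.univ.erase j, μ j' (Fin.last _))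
        (nhdsWithin 0 (Set.Ioi 0)) (nhds (μ j ⬝ᵥ w)) := by
      have : Continuous
          fun ε : ℝ => μ j ⬝ᵥ w + ε * ∑ j' ∈ Finset.univ.erase j, μ j' (Fin.last _) := by fun_prop
      exact tendsto_nhdsWithin_of_tendsto_nhds (by simpa using this.tendsto 0)
    exact le_of_tendsto hcont (by
      filter_upwards [self_mem_nhdsWithin] with ε hε
      exact hlim ε hε)
  -- Normalizing by `η` leaves an affine function that is nonnegative everywhere, hence constant.
  -- Its vanishing slope is the dual equation and its constant the dual inequality.
  have haff : ∀ z : κ → ℝ, 0 ≤ (φ - ∑ j, Matrix.vecMul ((-η⁻¹) • μ j) (A j)) ⬝ᵥ z +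
      (∑ j, ((-η⁻¹) • μ j) ⬝ᵥ b j + c₀) := by
    intro z
    have h1 := hs.trans (hE z)
    have h2 := mul_nonneg (inv_nonneg.2 hη0) h1
    rw [mul_add, inv_mul_cancel_left₀ hη.ne'] at h2
    rw [sub_dotProduct, sum_dotProduct]
    simp only [dotProduct_sub, Finset.sum_sub_distrib, Matrix.dotProduct_mulVec] at h2
    simp only [Matrix.smul_vecMul, smul_dotProduct, smul_eq_mul, ← Finset.mul_sum]
    linarith
  have h0 := eq_zero_of_forall_dotProduct_add_nonneg haff
  refine ⟨fun j => (-η⁻¹) • μ j, fun j => ?_, (sub_eq_zero.1 h0).symm, ?_⟩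
  · refine mem_secondOrderCone_of_dotProduct_nonneg fun w hw => ?_
    rw [smul_dotProduct, smul_eq_mul]
    exact mul_nonneg_of_nonpos_of_nonpos (by simpa using hη0) (hmem j w hw)
  · have := haff 0
    simpa using this

/-! ### Extended expectations and finite mixtures -/

/-- The extended expectation of an integrable function is its expectation. -/
theorem extExpectation_eq_integral {Ω : Type} [MeasurableSpace Ω] {μ : Measure Ω} {φ : Ω → ℝ}
    (h : Integrable φ μ) : extExpectation μ φ = ((∫ y, φ y ∂μ : ℝ) : EReal) := by
  have h1 : ∫⁻ y, ENNReal.ofReal (φ y) ∂μ ≠ ⊤ := h.lintegral_lt_top.ne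
  have h2 : ∫⁻ y, ENNReal.ofReal (-φ y) ∂μ ≠ ⊤ := h.neg.lintegral_lt_top.ne
  rw [extExpectation, integral_eq_lintegral_pos_part_sub_lintegral_neg_part h, EReal.coe_sub,
    EReal.coe_ennreal_toReal h1, EReal.coe_ennreal_toReal h2]

/-- No integrability is needed: the positive part grows, the negative part shrinks, and `⊤ - ⊤ = ⊥`
respects this. It applies to `c x`, which need not be measurable. -/
theorem extExpectation_mono {Ω : Type} [MeasurableSpace Ω] {μ : Measure Ω} {φ ψ : Ω → ℝ}
    (h : ∀ᵐ y ∂μ, φ y ≤ ψ y) : extExpectation μ φ ≤ extExpectation μ ψ := by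
  refine EReal.sub_le_sub ?_ ?_
  · exact EReal.coe_ennreal_le_coe_ennreal_iff.2
      (lintegral_mono_ae (h.mono fun y hy => ENNReal.ofReal_le_ofReal hy))
  · exact EReal.coe_ennreal_le_coe_ennreal_iff.2
      (lintegral_mono_ae (h.mono fun y hy => ENNReal.ofReal_le_ofReal (neg_le_neg hy)))

/-- The mixture of Dirac masses at the points `y a` with the weights `p a`. -/
noncomputable def diracMixture {Ω A : Type*} [MeasurableSpace Ω] [Fintype A] (p : A → ℝ)
    (y : A → Ω) : Measure Ω :=
  ∑ a, ENNReal.ofReal (p a) • Measure.dirac (y a)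

section diracMixture

variable {Ω A : Type*} [MeasurableSpace Ω] [Fintype A] {p : A → ℝ} {y : A → Ω}

theorem integrable_diracMixture [MeasurableSingletonClass Ω] (φ : Ω → ℝ) :
    Integrable φ (diracMixture p y) := by
  rw [diracMixture, integrable_finsetSum_measure]
  exact fun a _ => (integrable_dirac (by simp)).smul_measure ENNReal.ofReal_ne_top

theorem integral_diracMixture [MeasurableSingletonClass Ω] (hp : ∀ a, 0 ≤ p a)
    (φ : Ω → ℝ) :
    ∫ z, φ z ∂(diracMixture p y) = ∑ a, p a * φ (y a) := by
  rw [diracMixture, integral_finsetSum_measure fun a _ =>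
    (integrable_dirac (by simp)).smul_measure ENNReal.ofReal_ne_top]
  refine Finset.sum_congr rfl fun a _ => ?_
  rw [integral_smul_measure, integral_dirac, ENNReal.toReal_ofReal (hp a), smul_eq_mul]

theorem isProbabilityMeasure_diracMixture (hp : ∀ a, 0 ≤ p a) (hp1 : ∑ a, p a = 1) :
    IsProbabilityMeasure (diracMixture p y) := by
  constructor
  simp only [diracMixture, Measure.coe_finsetSum, Finset.sum_apply, Measure.smul_apply,
    measure_univ, smul_eq_mul, mul_one]
  rw [← ENNReal.ofReal_sum_of_nonneg fun a _ => hp a, hp1, ENNReal.ofReal_one]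

theorem ae_diracMixture [MeasurableSingletonClass Ω] {P : Ω → Prop} (h : ∀ a, P (y a)) :
    ∀ᵐ z ∂(diracMixture p y), P z := by
  rw [diracMixture, ae_iff, Measure.coe_finsetSum, Finset.sum_apply]
  refine Finset.sum_eq_zero fun a _ => ?_
  rw [Measure.smul_apply, Measure.dirac_apply]
  simp [h a]

end diracMixture

/-! ### Duality for the moment problem -/

namespace ParamSOCAmbiguity

variable {n K I : ℕ} (U : ParamSOCAmbiguity K I) (c : (Fin n → ℝ) → (Fin K → ℝ) → ℝ)
  {θ : U.Param} {x : Fin n → ℝ}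

/-- Weak duality for the moment problem. -/
theorem worstCaseExpectation_le {r : ℝ} {β : Fin I → ℝ} (hβ : ∀ i, 0 ≤ β i)
    (h : ∀ y ∈ U.supp, c x y ≤ r + ∑ i, β i * U.g i y (θ.1 i)) :
    worstCaseExpectation U c θ x ≤ ((r + ∑ i, β i * θ.2 i : ℝ) : EReal) := by
  refine iSup₂_le fun μ hμ => ?_
  obtain ⟨hprob, hsupp, hg⟩ := hμ
  have hint : Integrable (fun y => r + ∑ i, β i * U.g i y (θ.1 i)) μ :=
    (integrable_const r).add (integrable_finsetSum _ fun i _ => (hg i).1.const_mul _)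
  refine (extExpectation_mono (hsupp.mono fun y hy => h y hy)).trans ?_
  rw [extExpectation_eq_integral hint, EReal.coe_le_coe_iff,
    integral_add (integrable_const r) (integrable_finsetSum _ fun i _ => (hg i).1.const_mul _),
    integral_finsetSum _ fun i _ => (hg i).1.const_mul _]
  simp only [integral_const, probReal_univ, smul_eq_mul, one_mul, integral_const_mul]
  gcongr with i
  · exact hβ i
  · exact (hg i).2

theorem le_worstCaseExpectation_of_mixture {A : Type*} [Fintype A] {p : A → ℝ}
    (hp : ∀ a, 0 ≤ p a) (hp1 : ∑ a, p a = 1) {y : A → Fin K → ℝ} (hy : ∀ a, y a ∈ U.supp)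
    (hg : ∀ i, ∑ a, p a * U.g i (y a) (θ.1 i) ≤ θ.2 i) :
    ((∑ a, p a * c x (y a) : ℝ) : EReal) ≤ worstCaseExpectation U c θ x := by
  have hmem : diracMixture p y ∈ U.toSet θ := by
    refine ⟨isProbabilityMeasure_diracMixture hp hp1, ae_diracMixture hy, fun i =>
      ⟨integrable_diracMixture _, ?_⟩⟩
    rw [integral_diracMixture hp]
    exact hg i
  refine le_trans (le_of_eq ?_) (le_iSup₂ (f := fun μ _ => extExpectation μ (c x)) _ hmem)
  rw [extExpectation_eq_integral (integrable_diracMixture _), integral_diracMixture hp]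

/-- Strong duality for the moment problem: if the moment constraints are strictly feasible, the
dual problem attains every finite upper bound of the worst-case expectation. -/
theorem exists_moment_dual {y₀ : Fin K → ℝ} (hy₀ : y₀ ∈ U.supp)
    (hslater : ∀ i, U.g i y₀ (θ.1 i) < θ.2 i) {f : ℝ}
    (hf : worstCaseExpectation U c θ x ≤ (f : EReal)) :
    ∃ (r : ℝ) (β : Fin I → ℝ), (∀ i, 0 ≤ β i) ∧
      (∀ y ∈ U.supp, c x y ≤ r + ∑ i, β i * U.g i y (θ.1 i)) ∧ r + ∑ i, β i * θ.2 i ≤ f := by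
  classical
  let Φ : (Fin K → ℝ) → (Fin I → ℝ) × ℝ := fun y => (fun i => U.g i y (θ.1 i), c x y)
  let O : Set ((Fin I → ℝ) × ℝ) := (Set.univ.pi fun i => Set.Iio (θ.2 i)) ×ˢ Set.Ioi f
  have hOc : Convex ℝ O := (convex_pi fun i _ => convex_Iio _).prod (convex_Ioi _)
  have hOo : IsOpen O :=
    (isOpen_set_pi Set.finite_univ fun i _ => isOpen_Iio).prod isOpen_Ioi
  -- A hull point in `O` would be a Dirac mixture in the ambiguity set whose expected cost exceeds
  -- `f`.
  have hdisj : Disjoint O (convexHull ℝ (Φ '' U.supp)) := by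
    rw [Set.disjoint_left]
    rintro z ⟨h1, h2⟩ hz
    obtain ⟨A, _, p, w, hp, hp1, hw, rfl⟩ := mem_convexHull_iff_exists_fintype.1 hz
    choose y hy hyw using hw
    have h1' : ∀ i, ∑ a, p a * U.g i (y a) (θ.1 i) < θ.2 i := fun i => by
      have := h1 i (Set.mem_univ i)
      simpa [← hyw, Φ, Prod.fst_sum] using this
    have h2' : f < ∑ a, p a * c x (y a) := by
      simpa [← hyw, Φ, Prod.snd_sum, O] using h2
    have := (U.le_worstCaseExpectation_of_mixture c (x := x) hp hp1 hy
      fun i => (h1' i).le).trans hf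
    exact absurd (EReal.coe_le_coe_iff.1 this) (not_le.2 h2')
  obtain ⟨F, s, hFO, hFE⟩ := geometric_hahn_banach_open hOc hOo (convex_convexHull ℝ _) hdisj
  let β : Fin I → ℝ := fun i => F (Pi.single i 1, 0)
  let η : ℝ := F (0, 1)
  have hF : ∀ (u : Fin I → ℝ) (t : ℝ), F (u, t) = ∑ i, β i * u i + η * t := by
    intro u t
    have e : (u, t) = ∑ i, u i • ((Pi.single i 1, 0) : (Fin I → ℝ) × ℝ) + t • (0, 1) := by
      refine Prod.ext ?_ ?_
      · funext i
        simp [Prod.fst_sum, Finset.sum_apply, Pi.single_apply]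
      · simp [Prod.snd_sum]
    rw [e, map_add, map_sum, map_smul]
    simp only [map_smul, smul_eq_mul]
    rw [mul_comm t]
    congr 1
    exact Finset.sum_congr rfl fun i _ => mul_comm _ _
  have hO : ∀ u : Fin I → ℝ, (∀ i, u i < θ.2 i) → ∀ t, f < t → ∑ i, β i * u i + η * t < s :=
    fun u hu t ht => by rw [← hF]; exact hFO _ ⟨fun i _ => hu i, ht⟩
  have hE : ∀ y ∈ U.supp, s ≤ ∑ i, β i * U.g i y (θ.1 i) + η * c x y := fun y hy => by
    rw [← hF]; exact hFE _ (subset_convexHull ℝ _ ⟨y, hy, rfl⟩)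
  have hβ : ∀ i, 0 ≤ β i := by
    intro i
    have key : ∀ t : ℝ, 0 < t →
        t * (-β i) < s - (∑ i, β i * U.g i y₀ (θ.1 i) + η * (f + 1)) := by
      intro t ht
      -- Lowering moment `i` of the Slater point arbitrarily far stays in the box, which forces the
      -- sign of `β i`.
      have := hO (fun k => U.g k y₀ (θ.1 k) - if k = i then t else 0) (fun k => by
        have := hslater k
        split_ifs <;> linarith) (f + 1) (by linarith)
      simp only [mul_sub, Finset.sum_sub_distrib, mul_ite, mul_zero, Finset.sum_ite_eq',
        Finset.mem_univ, if_true] at this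
      linarith
    linarith [nonpos_of_forall_pos_mul_lt key]
  have hη : η < 0 := by
    have hη0 : η ≤ 0 := by
      have key : ∀ t : ℝ, 0 < t → t * η < s - (∑ i, β i * U.g i y₀ (θ.1 i) + η * f) := by
        intro t ht
        have := hO _ hslater (f + t) (by linarith)
        linarith
      exact nonpos_of_forall_pos_mul_lt key
    -- With `η = 0` the Slater moments would violate the separation, being in the hull and below
    -- `σ`.
    refine lt_of_le_of_ne hη0 fun h0 => ?_
    have h1 := hO _ hslater (f + 1) (by linarith)
    have h2 := hE y₀ hy₀
    rw [h0] at h1 h2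
    linarith
  -- The separation passes to the corner `(σ, f)` of the open box.
  have hlim : ∑ i, β i * θ.2 i + η * f ≤ s := by
    have hcont : Filter.Tendsto (fun ε : ℝ => ∑ i, β i * (θ.2 i - ε) + η * (f + ε))
        (nhdsWithin 0 (Set.Ioi 0)) (nhds (∑ i, β i * θ.2 i + η * f)) := by
      have : Continuous fun ε : ℝ => ∑ i, β i * (θ.2 i - ε) + η * (f + ε) := by fun_prop
      exact tendsto_nhdsWithin_of_tendsto_nhds (by simpa using this.tendsto 0)
    refine le_of_tendsto hcont ?_
    filter_upwards [self_mem_nhdsWithin] with ε hε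
    have hε' : (0 : ℝ) < ε := hε
    exact (hO _ (fun i => by linarith) _ (by linarith)).le
  have hκ : 0 < -η⁻¹ := by simpa using hη
  have hκη : -η⁻¹ * η = -1 := by rw [neg_mul, inv_mul_cancel₀ hη.ne]
  refine ⟨η⁻¹ * s, fun i => -η⁻¹ * β i, fun i => mul_nonneg hκ.le (hβ i), fun y hy => ?_, ?_⟩
  · have := mul_le_mul_of_nonneg_left (hE y hy) hκ.le
    rw [mul_add, ← mul_assoc _ η, hκη, Finset.mul_sum] at this
    simp only [← mul_assoc] at this
    linarith
  · have := mul_le_mul_of_nonneg_left hlim hκ.le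
    rw [mul_add, ← mul_assoc _ η, hκη, Finset.mul_sum] at this
    simp only [← mul_assoc] at this
    linarith

end ParamSOCAmbiguity

/-! ### Systems built from affine functions with differentiable coefficients -/

/-- A family of affine functions of finitely many real variables whose coefficients are
differentiable functions of a parameter on `D`. -/
def DiffAffineOn {P κ : Type*} [NormedAddCommGroup P] [NormedSpace ℝ P] [Fintype κ] (D : Set P)
    (f : P → (κ → ℝ) → ℝ) : Prop :=
  ∃ (a : P → κ → ℝ) (b : P → ℝ), (∀ k, DifferentiableOn ℝ (fun θ => a θ k) D) ∧
    DifferentiableOn ℝ b D ∧ ∀ θ z, f θ z = a θ ⬝ᵥ z + b θ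

namespace DiffAffineOn

variable {P κ : Type*} [NormedAddCommGroup P] [NormedSpace ℝ P] [Fintype κ] {D : Set P}
  {f g : P → (κ → ℝ) → ℝ}

theorem of_differentiableOn {b : P → ℝ} (hb : DifferentiableOn ℝ b D) :
    DiffAffineOn (κ := κ) D fun θ _ => b θ :=
  ⟨fun _ => 0, b, fun _ => differentiableOn_const _, hb, fun _ _ => by simp⟩

theorem const (b : ℝ) : DiffAffineOn (κ := κ) D fun _ _ => b :=
  of_differentiableOn (differentiableOn_const b)

theorem coord (k : κ) : DiffAffineOn (κ := κ) D fun _ z => z k := by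
  classical
  exact ⟨fun _ => Pi.single k 1, fun _ => 0, fun _ => differentiableOn_const _,
    differentiableOn_const _, fun _ _ => by simp⟩

theorem add (hf : DiffAffineOn D f) (hg : DiffAffineOn D g) :
    DiffAffineOn D fun θ z => f θ z + g θ z := by
  obtain ⟨a, b, ha, hb, h⟩ := hf
  obtain ⟨a', b', ha', hb', h'⟩ := hg
  refine ⟨fun θ => a θ + a' θ, fun θ => b θ + b' θ, fun k => (ha k).add (ha' k), hb.add hb',
    fun θ z => ?_⟩
  simp only [h, h', add_dotProduct]
  ring

theorem mul_left {s : P → ℝ} (hs : DifferentiableOn ℝ s D) (hf : DiffAffineOn D f) :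
    DiffAffineOn D fun θ z => s θ * f θ z := by
  obtain ⟨a, b, ha, hb, h⟩ := hf
  refine ⟨fun θ => s θ • a θ, fun θ => s θ * b θ, fun k => hs.mul (ha k), hs.mul hb,
    fun θ z => ?_⟩
  simp only [h, smul_dotProduct, smul_eq_mul]
  ring

theorem mul_right {s : P → ℝ} (hf : DiffAffineOn D f) (hs : DifferentiableOn ℝ s D) :
    DiffAffineOn D fun θ z => f θ z * s θ := by
  simpa only [mul_comm] using mul_left hs hf

theorem neg (hf : DiffAffineOn D f) : DiffAffineOn D fun θ z => -f θ z := by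
  simpa using mul_left (differentiableOn_const (-1)) hf

theorem sub (hf : DiffAffineOn D f) (hg : DiffAffineOn D g) :
    DiffAffineOn D fun θ z => f θ z - g θ z := by
  simpa only [sub_eq_add_neg] using hf.add hg.neg

theorem sum {β : Type*} (s : Finset β) {F : β → P → (κ → ℝ) → ℝ}
    (h : ∀ i, DiffAffineOn D (F i)) : DiffAffineOn D fun θ z => ∑ i ∈ s, F i θ z := by
  classical
  induction s using Finset.induction_on with
  | empty => simpa using const (κ := κ) (D := D) 0
  | insert i s hi ih => simpa only [Finset.sum_insert hi] using (h i).add ih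

theorem comp_coords {κ' : Type*} [Fintype κ'] (hf : DiffAffineOn D f) (e : κ → κ') :
    DiffAffineOn D fun θ z => f θ (fun k => z (e k)) := by
  obtain ⟨a, b, ha, hb, h⟩ := hf
  simp only [h, dotProduct]
  exact (sum _ fun k => mul_left (ha k) (coord (e k))).add (of_differentiableOn hb)

end DiffAffineOn

namespace SOCSystem

variable {P ι J N : Type} [NormedAddCommGroup P] [NormedSpace ℝ P] [Fintype ι] [Fintype J]
  [Fintype N] {D : Set P} {m : J → ℕ} {Φ : P → (j : J) → (ι ⊕ N → ℝ) → Fin (m j + 1) → ℝ}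

/-- The second-order cone system with the constraints `Φ_j(θ, (y, v)) ≥ 0`. -/
noncomputable def ofAffine (hΦ : ∀ j r, DiffAffineOn D fun θ z => Φ θ j z r) : SOCSystem P ι where
  J := J
  N := N
  m := m
  A θ j r := (hΦ j r).choose θ
  b θ j r := -(hΦ j r).choose_spec.choose θ

theorem ofAffine_dataDifferentiableOn (hΦ : ∀ j r, DiffAffineOn D fun θ z => Φ θ j z r) :
    (ofAffine hΦ).DataDifferentiableOn D :=
  ⟨fun j r => (hΦ j r).choose_spec.choose_spec.1,
    fun j r => (hΦ j r).choose_spec.choose_spec.2.1.neg⟩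

theorem ofAffine_holds_iff (hΦ : ∀ j r, DiffAffineOn D fun θ z => Φ θ j z r) (θ : P) (y : ι → ℝ)
    (v : N → ℝ) :
    (ofAffine hΦ).Holds θ y v ↔ ∀ j, Φ θ j (Sum.elim y v) ∈ secondOrderCone (m j) := by
  refine forall_congr' fun j => ?_
  have e : ((ofAffine hΦ).A θ j).mulVec (Sum.elim y v) - (ofAffine hΦ).b θ j =
      Φ θ j (Sum.elim y v) := by
    funext r
    exact (sub_neg_eq_add _ _).trans ((hΦ j r).choose_spec.choose_spec.2.2 θ (Sum.elim y v)).symm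
  rw [e]
  rfl

end SOCSystem

/-! ### Costs as finite maxima of affine functions -/

/-- A second-order cone description of a cost function on `X × Ξ`: with auxiliary variables `t`
subject to second-order cone constraints in `(x, t)`, the cost is the smallest possible maximum of
finitely many functions that are affine in `y`, with coefficients affine in `(x, t)`. The
parameter type `P` is only used to express affineness. -/
structure CostRepresentation {n K : ℕ} (P : Type) [NormedAddCommGroup P] [NormedSpace ℝ P]
    (D : Set P) (X : Set (Fin n → ℝ)) (supp : Set (Fin K → ℝ))
    (c : (Fin n → ℝ) → (Fin K → ℝ) → ℝ) where
  J : Type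
  [fintypeJ : Fintype J]
  N : Type
  [fintypeN : Fintype N]
  L : Type
  [fintypeL : Fintype L]
  m : J → ℕ
  Φ : (j : J) → (Fin n ⊕ N → ℝ) → Fin (m j + 1) → ℝ
  a : L → (Fin n ⊕ N → ℝ) → ℝ
  d : L → Fin K → (Fin n ⊕ N → ℝ) → ℝ
  affine_Φ : ∀ j r, DiffAffineOn D fun (_ : P) z => Φ j z r
  affine_a : ∀ l, DiffAffineOn D fun (_ : P) z => a l z
  affine_d : ∀ l k, DiffAffineOn D fun (_ : P) z => d l k z
  cost_le : ∀ x ∈ X, ∀ t : N → ℝ, (∀ j, Φ j (Sum.elim x t) ∈ secondOrderCone (m j)) →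
    ∀ y ∈ supp, ∃ l, c x y ≤ a l (Sum.elim x t) + ∑ k, d l k (Sum.elim x t) * y k
  exists_le_cost : ∀ x ∈ X, ∃ t : N → ℝ, (∀ j, Φ j (Sum.elim x t) ∈ secondOrderCone (m j)) ∧
    ∀ y ∈ supp, ∀ l, a l (Sum.elim x t) + ∑ k, d l k (Sum.elim x t) * y k ≤ c x y

attribute [instance] CostRepresentation.fintypeJ CostRepresentation.fintypeN
  CostRepresentation.fintypeL

section cost

variable {n K : ℕ} (P : Type) [NormedAddCommGroup P] [NormedSpace ℝ P] (D : Set P)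
  {X : Set (Fin n → ℝ)} {supp : Set (Fin K → ℝ)} {c : (Fin n → ℝ) → (Fin K → ℝ) → ℝ}

/-- One affine piece suffices: auxiliary variables `s_k ≥ c_k(x)` replace the coefficients, and `y ≥
0` makes `∑ s_k y_k` an upper bound that is tight at `s_k = c_k(x)`. -/
theorem IsSingleStageCost.nonempty_costRepresentation (hc : IsSingleStageCost supp c) :
    Nonempty (CostRepresentation P D X supp c) := by
  obtain ⟨⟨ck, hck, hsum⟩, hpos⟩ := hc
  choose S hS using hck
  have hepi : ∀ k x s, ck k x ≤ s ↔ ∃ v, (S k).Holds () (Sum.elim x fun _ => s) v :=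
    fun k x s => by rw [← hS k]; simp [epigraph]
  exact ⟨{
    J := Σ k, (S k).J
    N := Fin K ⊕ Σ k, (S k).N
    L := Unit
    m := fun j => (S j.1).m j.2
    Φ := fun j z => ((S j.1).A () j.2).mulVec
      (fun e => z (Sum.elim (Sum.elim Sum.inl fun _ => Sum.inr (Sum.inl j.1))
        (fun v => Sum.inr (Sum.inr ⟨j.1, v⟩)) e)) - (S j.1).b () j.2
    a := fun _ _ => 0
    d := fun _ k z => z (Sum.inr (Sum.inl k))
    affine_Φ := fun j r => by
      simp only [Pi.sub_apply, Matrix.mulVec, dotProduct]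
      exact (DiffAffineOn.sum _ fun e =>
        (DiffAffineOn.coord _).mul_left (differentiableOn_const _)).sub (DiffAffineOn.const _)
    affine_a := fun _ => DiffAffineOn.const _
    affine_d := fun _ _ => DiffAffineOn.coord _
    cost_le := fun x _ t ht y hy => by
      refine ⟨(), ?_⟩
      rw [hsum, zero_add]
      refine Finset.sum_le_sum fun k _ => mul_le_mul_of_nonneg_right ?_ (hpos y hy k)
      refine (hepi k x _).2 ⟨fun v => t (Sum.inr ⟨k, v⟩), fun j => ?_⟩
      convert ht ⟨k, j⟩ using 3
      funext e
      rcases e with (e | e) | e <;> rfl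
    exists_le_cost := fun x _ => by
      choose v hv using fun k => (hepi k x (ck k x)).1 le_rfl
      refine ⟨Sum.elim (fun k => ck k x) (fun e => v e.1 e.2), fun j => ?_, fun y _ _ => ?_⟩
      · convert hv j.1 j.2 using 3
        funext e
        rcases e with (e | e) | e <;> rfl
      · rw [hsum, zero_add]
        rfl }⟩

/-- The dual polyhedron need not have vertices. Instead, one multiplier is chosen from each nonempty
face, a face being given by a set `B` of tight dual constraints. If `B` is the support of an optimal
`γ`, any multiplier in that face is optimal by complementarity. The finite family depends only on
`W` and `q`. -/
theorem IsTwoStageCost.nonempty_costRepresentation (hc : IsTwoStageCost X supp c) :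
    Nonempty (CostRepresentation P D X supp c) := by
  classical
  obtain ⟨M, G, T₀, T, h₀, h, W, q, hc⟩ := hc
  let L := {B : Finset (Fin G) // ∃ π : Fin M → ℝ, (∀ l, Matrix.vecMul π W l ≤ q l) ∧
    ∀ l ∈ B, Matrix.vecMul π W l = q l}
  choose π hπ hπB using fun l : L => l.2
  have hexp : ∀ (l : L) (x : Fin n → ℝ) (y : Fin K → ℝ),
      π l ⬝ᵥ (h₀ - T₀.mulVec x) + ∑ k, π l ⬝ᵥ (h k - (T k).mulVec x) * y k =
        π l ⬝ᵥ ((h₀ + ∑ k, y k • h k) - (T₀ + ∑ k, y k • T k).mulVec x) := by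
    intro l x y
    rw [Matrix.add_mulVec, Matrix.sum_mulVec]
    simp only [dotProduct_sub, dotProduct_add, dotProduct_sum, dotProduct_smul, Matrix.smul_mulVec,
      smul_eq_mul, sub_mul, Finset.sum_sub_distrib, mul_comm (y _)]
    ring
  have hrhs : ∀ {x y γ}, γ ∈ recourseFeasible T₀ T h₀ h W x y →
      (h₀ + ∑ k, y k • h k) - (T₀ + ∑ k, y k • T k).mulVec x = W.mulVec γ :=
    fun hγ => sub_eq_iff_eq_add'.2 hγ.2.symm
  have haff : ∀ (p : Fin M → ℝ) (b : Fin M → ℝ) (B : Matrix (Fin M) (Fin n) ℝ),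
      DiffAffineOn D fun (_ : P) (z : Fin n ⊕ Empty → ℝ) =>
        p ⬝ᵥ (b - B.mulVec fun i => z (Sum.inl i)) := by
    intro p b B
    simp only [dotProduct, Pi.sub_apply, Matrix.mulVec]
    exact DiffAffineOn.sum _ fun i => ((DiffAffineOn.const _).sub (DiffAffineOn.sum _ fun e =>
      (DiffAffineOn.coord _).mul_left (differentiableOn_const _))).mul_left
        (differentiableOn_const _)
  exact ⟨{
    J := Empty
    N := Empty
    L := L
    m := fun j => j.elim
    Φ := fun j => j.elim
    a := fun l z => π l ⬝ᵥ (h₀ - T₀.mulVec fun i => z (Sum.inl i))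
    d := fun l k z => π l ⬝ᵥ (h k - (T k).mulVec fun i => z (Sum.inl i))
    affine_Φ := fun j => j.elim
    affine_a := fun l => haff _ _ _
    affine_d := fun l k => haff _ _ _
    cost_le := fun x hx t _ y hy => by
      obtain ⟨-, ⟨γ, hγ, hγc⟩, hmin⟩ := hc x hx y hy
      obtain ⟨p, hp, hpB⟩ := exists_complementary_multiplier W q γ hγ.1 fun γ' hγ' he => by
        refine le_trans (le_of_eq hγc) (hmin ⟨γ', ⟨hγ', ?_⟩, rfl⟩)
        rw [he]
        exact hγ.2
      let l : L :=
        ⟨Finset.univ.filter fun l => γ l ≠ 0, p, hp, fun l hl => hpB l (by simpa using hl)⟩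
      refine ⟨l, le_of_eq ?_⟩
      simp only [Sum.elim_inl]
      rw [hexp l x y, hrhs hγ, Matrix.dotProduct_mulVec, ← hγc]
      refine Finset.sum_congr rfl fun i _ => ?_
      by_cases hi : γ i = 0
      · simp [hi]
      · rw [hπB l i (by simpa [l] using hi)]
    exists_le_cost := fun x hx => by
      refine ⟨Empty.elim, fun j => j.elim, fun y hy l => ?_⟩
      obtain ⟨-, ⟨γ, hγ, hγc⟩, -⟩ := hc x hx y hy
      simp only [Sum.elim_inl]
      rw [hexp l x y, hrhs hγ, Matrix.dotProduct_mulVec, ← hγc]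
      exact Finset.sum_le_sum fun i _ => mul_le_mul_of_nonneg_right (hπ l i) (hγ.1 i) }⟩

end cost

/-! ### The dual second-order cone program -/

namespace DualProgram

variable {n K I : ℕ} {X : Set (Fin n → ℝ)} {U : ParamSOCAmbiguity K I}
  {c : (Fin n → ℝ) → (Fin K → ℝ) → ℝ}
  (C : CostRepresentation U.Param U.paramDom X U.supp c)
  (R : SOCSystem U.Param (Fin K ⊕ Fin I))

/-- The variables of the dual program: the multiplier `r` of the total mass, the multipliers `β`
of the moment constraints, the conic multipliers `λ`, and the auxiliary variables of the cost. -/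
abbrev Var : Type :=
  (Unit ⊕ Fin I) ⊕ (Σ p : C.L × R.J, Fin (R.m p.2 + 1)) ⊕ C.N

/-- The constraints: those of the cost, `β ≥ 0`, `λ ≥ 0`, the inequality for the constant term, and
the equations for the coefficients, written as pairs of inequalities. -/
abbrev Con : Type :=
  (C.J ⊕ Fin I) ⊕ ((C.L × R.J) ⊕ C.L) ⊕ (C.L × ((Fin K ⊕ Fin I) ⊕ R.N)) × Bool

/-- The sizes of the constraints. -/
def size : Con C R → ℕ
  | Sum.inl (Sum.inl j) => C.m j
  -- Size `0` is the one-dimensional cone, the half-line of nonnegative numbers, so it encodes a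
  -- scalar inequality.
  | Sum.inl (Sum.inr _) => 0
  | Sum.inr (Sum.inl (Sum.inl p)) => R.m p.2
  | Sum.inr (Sum.inl (Sum.inr _)) => 0
  | Sum.inr (Sum.inr _) => 0

variable {C R}

/-- The variables `(x, t)` of the cost representation. -/
def costVar (z : Fin n ⊕ Var C R → ℝ) : Fin n ⊕ C.N → ℝ :=
  fun e => z (Sum.map id (Sum.inr ∘ Sum.inr) e)

/-- The conic multiplier of the inequality `j` for the affine piece `l`. -/
def conicVar (z : Fin n ⊕ Var C R → ℝ) (l : C.L) (j : R.J) : Fin (R.m j + 1) → ℝ :=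
  fun r => z (Sum.inr (Sum.inr (Sum.inl ⟨(l, j), r⟩)))

/-- The multipliers of the moment constraints. -/
def momentVar (z : Fin n ⊕ Var C R → ℝ) (i : Fin I) : ℝ := z (Sum.inr (Sum.inl (Sum.inr i)))

/-- The multiplier of the total mass. -/
def massVar (z : Fin n ⊕ Var C R → ℝ) : ℝ := z (Sum.inr (Sum.inl (Sum.inl ())))

/-- The coefficients of the affine function `r + β u - a_l - d_l y` of `(y, u, v)`. -/
def coefficients (z : Fin n ⊕ Var C R → ℝ) (l : C.L) : (Fin K ⊕ Fin I) ⊕ R.N → ℝ :=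
  Sum.elim (Sum.elim (fun k => -C.d l k (costVar z)) (momentVar z)) 0

variable (C R)

/-- The constraint functions. -/
def constraint (θ : U.Param) : (j : Con C R) → (Fin n ⊕ Var C R → ℝ) → Fin (size C R j + 1) → ℝ
  | Sum.inl (Sum.inl j), z => C.Φ j (costVar z)
  | Sum.inl (Sum.inr i), z => fun _ => momentVar z i
  | Sum.inr (Sum.inl (Sum.inl p)), z => conicVar z p.1 p.2
  | Sum.inr (Sum.inl (Sum.inr l)), z => fun _ =>
      ∑ j, conicVar z l j ⬝ᵥ R.b θ j + (massVar z - C.a l (costVar z))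
  | Sum.inr (Sum.inr ((l, e), s)), z => fun _ =>
      let δ := (∑ j, Matrix.vecMul (conicVar z l j) (R.A θ j)) e - coefficients z l e
      if s then δ else -δ

variable {R}

theorem constraint_diffAffineOn (hR : R.DataDifferentiableOn U.paramDom) :
    ∀ j r, DiffAffineOn U.paramDom fun θ z => constraint C R θ j z r := by
  have hconic : ∀ (l : C.L) (j : R.J) r, DiffAffineOn U.paramDom
      fun (_ : U.Param) (z : Fin n ⊕ Var C R → ℝ) => conicVar z l j r :=
    fun l j r => DiffAffineOn.coord _
  have hcoef : ∀ (l : C.L) e, DiffAffineOn U.paramDom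
      fun (_ : U.Param) (z : Fin n ⊕ Var C R → ℝ) => coefficients z l e := by
    rintro l ((k | i) | v)
    · exact ((C.affine_d l k).comp_coords _).neg
    · exact DiffAffineOn.coord _
    · exact DiffAffineOn.const 0
  have hδ : ∀ (l : C.L) e, DiffAffineOn U.paramDom fun θ (z : Fin n ⊕ Var C R → ℝ) =>
      (∑ j, Matrix.vecMul (conicVar z l j) (R.A θ j)) e - coefficients z l e := by
    intro l e
    simp only [Finset.sum_apply, Matrix.vecMul, dotProduct]
    exact (DiffAffineOn.sum _ fun j => DiffAffineOn.sum _ fun r =>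
      (hconic l j r).mul_right (hR.1 j r e)).sub (hcoef l e)
  rintro ((j | i) | (p | l) | ⟨⟨l, e⟩, _ | _⟩) r
  · exact (C.affine_Φ j r).comp_coords _
  · exact DiffAffineOn.coord _
  · exact DiffAffineOn.coord _
  · simp only [constraint, dotProduct]
    exact (DiffAffineOn.sum _ fun j => DiffAffineOn.sum _ fun r =>
      (hconic l j r).mul_right (hR.2 j r)).add
        ((DiffAffineOn.coord _).sub ((C.affine_a l).comp_coords _))
  · simpa only [constraint, Bool.false_eq_true, if_false] using (hδ l e).neg
  · simpa only [constraint, if_true] using hδ l e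

/-- The dual second-order cone program of the worst-case expectation. -/
noncomputable def program (hR : R.DataDifferentiableOn U.paramDom) :
    SOCSystem U.Param (Fin n) :=
  SOCSystem.ofAffine (constraint_diffAffineOn C hR)

theorem program_holds_iff (hR : R.DataDifferentiableOn U.paramDom) (θ : U.Param) (x : Fin n → ℝ)
    (w : Var C R → ℝ) :
    (program C hR).Holds θ x w ↔
      (∀ j, C.Φ j (costVar (Sum.elim x w)) ∈ secondOrderCone (C.m j)) ∧
      (∀ i, 0 ≤ momentVar (C := C) (R := R) (Sum.elim x w) i) ∧
      ∀ l, (∀ j, conicVar (Sum.elim x w) l j ∈ secondOrderCone (R.m j)) ∧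
        (∑ j, Matrix.vecMul (conicVar (Sum.elim x w) l j) (R.A θ j) =
          coefficients (Sum.elim x w) l) ∧
        0 ≤ ∑ j, conicVar (Sum.elim x w) l j ⬝ᵥ R.b θ j +
          (massVar (Sum.elim x w) - C.a l (costVar (Sum.elim x w))) := by
  refine (SOCSystem.ofAffine_holds_iff (constraint_diffAffineOn C hR) θ x w).trans ?_
  constructor
  · intro h
    refine ⟨fun j => h (Sum.inl (Sum.inl j)), fun i => ?_, fun l => ⟨fun j => ?_, ?_, ?_⟩⟩
    · exact (mem_secondOrderCone_zero_iff _).1 (h (Sum.inl (Sum.inr i)))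
    · exact h (Sum.inr (Sum.inl (Sum.inl (l, j))))
    · funext e
      have h1 := (mem_secondOrderCone_zero_iff _).1 (h (Sum.inr (Sum.inr ((l, e), true))))
      have h2 := (mem_secondOrderCone_zero_iff _).1 (h (Sum.inr (Sum.inr ((l, e), false))))
      simp only [constraint, if_true, Bool.false_eq_true, if_false] at h1 h2
      linarith
    · exact (mem_secondOrderCone_zero_iff _).1 (h (Sum.inr (Sum.inl (Sum.inr l))))
  · rintro ⟨h1, h2, h3⟩ ((j | i) | (p | l) | ⟨⟨l, e⟩, s⟩)
    · exact h1 j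
    · exact (mem_secondOrderCone_zero_iff _).2 (h2 i)
    · exact (h3 p.1).1 p.2
    · exact (mem_secondOrderCone_zero_iff _).2 (h3 l).2.2
    · refine (mem_secondOrderCone_zero_iff _).2 ?_
      simp only [constraint, (h3 l).2.1, sub_self, neg_zero, ite_self, le_refl]

variable (R)

/-- The objective `r + β σ`. -/
def objective (θ : U.Param) : Var C R → ℝ :=
  Sum.elim (Sum.elim (fun _ => 1) θ.2) 0

variable {R}

theorem objective_dotProduct (θ : U.Param) (x : Fin n → ℝ) (w : Var C R → ℝ) :
    objective C R θ ⬝ᵥ w = massVar (C := C) (R := R) (Sum.elim x w) +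
      ∑ i, momentVar (C := C) (R := R) (Sum.elim x w) i * θ.2 i := by
  simp [objective, dotProduct, Fintype.sum_sum_type, massVar, momentVar, mul_comm]

theorem objective_differentiableOn (v : Var C R) :
    DifferentiableOn ℝ (fun θ => objective C R θ v) U.paramDom := by
  rcases v with (_ | i) | _
  · exact differentiableOn_const _
  · simp only [objective, Sum.elim_inl, Sum.elim_inr]
    fun_prop
  · exact differentiableOn_const _

/-- Feasible points of the program bound the worst-case expectation. -/
theorem worstCaseExpectation_le_objective (hR : R.Represents U.paramDom U.lifted) {θ : U.Param}
    (hθ : θ ∈ U.paramDom) {x : Fin n → ℝ} (hx : x ∈ X) {w : Var C R → ℝ}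
    (hw : (program C hR.1).Holds θ x w) :
    worstCaseExpectation U c θ x ≤ ((objective C R θ ⬝ᵥ w : ℝ) : EReal) := by
  obtain ⟨hΦ, hβ, hl⟩ := (program_holds_iff C hR.1 θ x w).1 hw
  rw [objective_dotProduct C θ x w]
  refine U.worstCaseExpectation_le c hβ fun y hy => ?_
  have hcost : costVar (Sum.elim x w) =
      Sum.elim x fun t => w (Sum.inr (Sum.inr t)) := by
    funext e
    rcases e with e | e <;> rfl
  rw [hcost] at hΦ
  obtain ⟨l, hle⟩ := C.cost_le x hx _ hΦ y hy
  rw [← hcost] at hle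
  -- The lifted point over `y` with `u i` equal to `g i` at `y` is tested against the certificate of
  -- the piece that dominates the cost there.
  obtain ⟨v, hv⟩ := (hR.2 θ hθ (Sum.elim y fun i => U.g i y (θ.1 i))).1
    ⟨by simpa using hy, fun i => by simp⟩
  obtain ⟨hcone, heq, hconst⟩ := hl l
  have hnn : 0 ≤ ∑ j, conicVar (Sum.elim x w) l j ⬝ᵥ ((R.A θ j).mulVec
      (Sum.elim (Sum.elim y fun i => U.g i y (θ.1 i)) v) - R.b θ j) :=
    Finset.sum_nonneg fun j _ => secondOrderCone_dotProduct_nonneg (hcone j) (hv j)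
  simp only [dotProduct_sub, Finset.sum_sub_distrib, Matrix.dotProduct_mulVec] at hnn
  rw [← sum_dotProduct, heq] at hnn
  simp only [coefficients, sumElim_dotProduct_sumElim, zero_dotProduct, add_zero] at hnn
  simp only [dotProduct, neg_mul, Finset.sum_neg_distrib] at hnn
  simp only [dotProduct] at hconst
  linarith

/-- Under Slater's condition the program attains the worst-case expectation if that is finite. -/
theorem exists_holds_objective_le (hR : R.Represents U.paramDom U.lifted) {θ : U.Param}
    (hθ : θ ∈ U.paramDom) (hS : U.Slater R θ) {x : Fin n → ℝ} (hx : x ∈ X) {f : ℝ}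
    (hf : worstCaseExpectation U c θ x ≤ (f : EReal)) :
    ∃ w : Var C R → ℝ, (program C hR.1).Holds θ x w ∧ objective C R θ ⬝ᵥ w ≤ f := by
  obtain ⟨y₀, u₀, v₀, hu₀, hv₀⟩ := hS
  obtain ⟨hy₀, hg₀⟩ := (hR.2 θ hθ (Sum.elim y₀ u₀)).2
    ⟨v₀, fun j => secondOrderConeStrict_subset _ (hv₀ j)⟩
  simp only [Sum.elim_inl, Sum.elim_inr] at hy₀ hg₀
  obtain ⟨r, β, hβ, hdual, hobj⟩ := U.exists_moment_dual c hy₀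
    (fun i => (hg₀ i).trans_lt (hu₀ i)) hf
  obtain ⟨t, ht, hle⟩ := C.exists_le_cost x hx
  -- For every piece, `r + β u - a_l - d_l y` is nonnegative on the lifted support, since `β ≥ 0`,
  -- `u ≥ g` and the piece lies below the cost. Conic duality supplies its certificate.
  choose lam hcone heq hconst using fun l : C.L => exists_dual_multipliers R.m (R.A θ) (R.b θ)
    (Sum.elim (Sum.elim y₀ u₀) v₀) hv₀
    (Sum.elim (Sum.elim (fun k => -C.d l k (Sum.elim x t)) β) 0)
    (r - C.a l (Sum.elim x t)) fun z hz => by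
      obtain ⟨hy, hg⟩ := (hR.2 θ hθ fun e => z (Sum.inl e)).2
        ⟨fun e => z (Sum.inr e), fun j => by
          convert hz j using 3
          funext e
          rcases e with e | e <;> rfl⟩
      have h1 := hle _ hy l
      have h2 := hdual _ hy
      have h3 : ∑ i, β i * U.g i (fun k => z (Sum.inl (Sum.inl k))) (θ.1 i) ≤
          ∑ i, β i * z (Sum.inl (Sum.inr i)) :=
        Finset.sum_le_sum fun i _ => mul_le_mul_of_nonneg_left (hg i) (hβ i)
      simp only [dotProduct, Fintype.sum_sum_type, Sum.elim_inl, Sum.elim_inr, Pi.zero_apply,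
        zero_mul, Finset.sum_const_zero, add_zero, neg_mul, Finset.sum_neg_distrib]
      linarith
  let w : Var C R → ℝ := Sum.elim (Sum.elim (fun _ => r) β)
    (Sum.elim (fun p => lam p.1.1 p.1.2 p.2) t)
  have hcost : costVar (Sum.elim x w) = Sum.elim x t := by
    funext e
    rcases e with e | e <;> rfl
  refine ⟨w, (program_holds_iff C hR.1 θ x w).2 ⟨?_, hβ, fun l => ⟨hcone l, ?_, ?_⟩⟩, ?_⟩
  · rw [hcost]
    exact ht
  · rw [coefficients, hcost]
    exact heq l
  · rw [hcost]
    exact hconst l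
  · rw [objective_dotProduct C θ x w]
    exact hobj

end DualProgram

/-! ### Equality of the values and attainment -/

/-- The Dirac mass at the Slater point belongs to the ambiguity set and has a finite expected cost.
-/
theorem ParamSOCAmbiguity.Slater.worstCaseExpectation_ne_bot {n K I : ℕ}
    {U : ParamSOCAmbiguity K I} {R : SOCSystem U.Param (Fin K ⊕ Fin I)}
    (hR : R.Represents U.paramDom U.lifted) {θ : U.Param} (hθ : θ ∈ U.paramDom)
    (hS : U.Slater R θ) (c : (Fin n → ℝ) → (Fin K → ℝ) → ℝ) (x : Fin n → ℝ) :
    worstCaseExpectation U c θ x ≠ ⊥ := by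
  obtain ⟨y₀, u₀, v₀, hu₀, hv₀⟩ := hS
  obtain ⟨hy₀, hg₀⟩ := (hR.2 θ hθ (Sum.elim y₀ u₀)).2
    ⟨v₀, fun j => secondOrderConeStrict_subset _ (hv₀ j)⟩
  simp only [Sum.elim_inl, Sum.elim_inr] at hy₀ hg₀
  have := U.le_worstCaseExpectation_of_mixture c (θ := θ) (x := x) (A := Unit) (p := fun _ => 1)
    (fun _ => zero_le_one) (by simp) (y := fun _ => y₀) (fun _ => hy₀)
    (fun i => by simpa using (hg₀ i).trans (hu₀ i).le)
  exact ne_bot_of_le_ne_bot (EReal.coe_ne_bot _) this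

theorem mainTheorem2 {n K I : ℕ} (X : Set (Fin n → ℝ)) (U : ParamSOCAmbiguity K I)
    (c : (Fin n → ℝ) → (Fin K → ℝ) → ℝ)
    (hc : IsSingleStageCost U.supp c ∨ IsTwoStageCost X U.supp c)
    (R : SOCSystem U.Param (Fin K ⊕ Fin I)) (hR : R.Represents U.paramDom U.lifted) :
    ∃ (S : SOCSystem U.Param (Fin n)) (q : U.Param → S.N → ℝ),
      S.DataDifferentiableOn U.paramDom ∧
      (∀ a, DifferentiableOn ℝ (fun θ => q θ a) U.paramDom) ∧
      ∀ θ ∈ U.paramDom, U.Slater R θ → ∀ x ∈ X,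
        worstCaseExpectation U c θ x = S.programValue q θ x ∧
        (worstCaseExpectation U c θ x ≠ ⊤ →
          ∃ w, S.Holds θ x w ∧ ((q θ ⬝ᵥ w : ℝ) : EReal) = worstCaseExpectation U c θ x) := by
  obtain ⟨C⟩ : Nonempty (CostRepresentation U.Param U.paramDom X U.supp c) :=
    hc.elim (fun h => h.nonempty_costRepresentation _ _) fun h => h.nonempty_costRepresentation _ _
  refine ⟨DualProgram.program C hR.1, DualProgram.objective C R,
    SOCSystem.ofAffine_dataDifferentiableOn _, DualProgram.objective_differentiableOn C,
    fun θ hθ hS x hx => ?_⟩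
  have hweak : ∀ w, (DualProgram.program C hR.1).Holds θ x w →
      worstCaseExpectation U c θ x ≤ ((DualProgram.objective C R θ ⬝ᵥ w : ℝ) : EReal) :=
    fun w hw => DualProgram.worstCaseExpectation_le_objective C hR hθ hx hw
  have hatt : worstCaseExpectation U c θ x ≠ ⊤ → ∃ w, (DualProgram.program C hR.1).Holds θ x w ∧
      ((DualProgram.objective C R θ ⬝ᵥ w : ℝ) : EReal) = worstCaseExpectation U c θ x := by
    intro htop
    -- The worst case is now a real number, so it can itself serve as the bound `f` in strong
    -- duality.
    have hcoe := EReal.coe_toReal htop (hS.worstCaseExpectation_ne_bot hR hθ c x)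
    obtain ⟨w, hw, hle⟩ := DualProgram.exists_holds_objective_le C hR hθ hS hx hcoe.ge
    refine ⟨w, hw, le_antisymm ?_ (hweak w hw)⟩
    rw [← hcoe]
    exact EReal.coe_le_coe_iff.2 hle
  refine ⟨le_antisymm (le_iInf₂ hweak) ?_, hatt⟩
  by_cases htop : worstCaseExpectation U c θ x = ⊤
  · rw [htop]
    exact le_top
  · obtain ⟨w, hw, heq⟩ := hatt htop
    rw [← heq]
    exact iInf₂_le w hw
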